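/- Let $V$ be a countably infinite set and let $(b,0)$ be a connected weighted graph over $V$: $b:V\times V\to[0,\infty)$ satisfies $b(x,x)=0$, $b(x,y)=b(y,x)$ and $\sum_{y}b(x,y)<\infty$ for all $x,y\in V$ (local finiteness is not assumed), and any two vertices are joined by a finite path along pairs with $b>0$. Let $m:V\to(0,\infty)$ and write $\langle u,v\rangle=\sum_x u(x)v(x)m(x)$. Let $\widetilde D$ be the space of all $u:V\to\mathbb R$ with $\frac12\sum_{x,y}b(x,y)(u(x)-u(y))^2<\infty$ (functions of finite energy), and for $u,v\in\widetilde D$ put $$\widetilde Q(u,v)=\tfrac12\sum_{x,y\in V}b(x,y)(u(x)-u(y))(v(x)-v(y)),\qquad \widetilde Lv(x)=\frac1{m(x)}\sum_{y\in V}b(x,y)(v(x)-v(y)).$$ Let $Q^D$ be the restriction of $\widetilde Q$ to the closure $D(Q^D)$ of the finitely supported functions in $\widetilde D\cap\ell^2(V,m)$ with respect to the norm $(\widetilde Q(u,u)+\|u\|_2^2)^{1/2}$. Let $L$ be the self-adjoint operator on $\ell^2(V,m)$ associated with $Q^D$ (that is, $u\in D(L)$ and $Lu=w$ if and only if $u\in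 D(Q^D)$, $w\in\ell^2(V,m)$ and $Q^D(u,v)=\langle w,v\rangle$ for all $v\in D(Q^D)$), and let $(e^{-tL})_{t>0}$ be the strongly continuous semigroup of self-adjoint contractions generated by $-L$. The form $Q^D$ is called recurrent if $\int_0^\infty (e^{-tL}\delta_x)(y)\,dt=\infty$ for all $x,y\in V$, where $\delta_x$ is $1$ at $x$ and $0$ elsewhere. Theorem. $Q^D$ is recurrent if and only if $$R(u,v):=\widetilde Q(u,v)-\langle u,\widetilde Lv\rangle=0$$ for all bounded $u\in\widetilde D$ and all $v\in\widetilde D$ with $\widetilde Lv\in\ell^1(V,m)$. -/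

import Mathlib

open Filter Topology MeasureTheory

/-- A weighted graph `(b, 0)` over `V` (the killing term `c` is identically zero). -/
structure WeightedGraph (V : Type*) where
  b : V → V → ℝ
  b_nonneg : ∀ x y, 0 ≤ b x y
  b_self : ∀ x, b x x = 0
  b_symm : ∀ x y, b x y = b y x
  b_summable : ∀ x, Summable fun y => b x y

namespace WeightedGraph

variable {V : Type*}

/-- Every two vertices are joined by a finite path of edges of positive weight. -/
def Connected (G : WeightedGraph V) : Prop :=
  ∀ x y, Relation.ReflTransGen (fun z w => 0 < G.b z w) x y

/-- Functions of finite energy: the space `D̃` of all `u` with `Q̃(u) < ∞`. -/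
def FiniteEnergy (G : WeightedGraph V) (u : V → ℝ) : Prop :=
  Summable fun p : V × V => G.b p.1 p.2 * (u p.1 - u p.2) ^ 2

/-- The bilinear form `Q̃(u, v)`; the sum converges absolutely for `u`, `v` of finite energy. -/
noncomputable def form (G : WeightedGraph V) (u v : V → ℝ) : ℝ :=
  (1 / 2) * ∑' p : V × V, G.b p.1 p.2 * (u p.1 - u p.2) * (v p.1 - v p.2)

/-- The formal Laplacian `L̃` with respect to the measure `m`. -/
noncomputable def laplacian (G : WeightedGraph V) (m : V → ℝ) (u : V → ℝ) (x : V) : ℝ :=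
  (1 / m x) * ∑' y, G.b x y * (u x - u y)

end WeightedGraph

section WeightedSequenceSpaces

variable {V : Type*}

/-- `u ∈ ℓ¹(V, m)`. -/
def MemEllOne (m : V → ℝ) (u : V → ℝ) : Prop := Summable fun x => |u x| * m x

/-- `u ∈ ℓ^∞(V)`. -/
def MemEllInfty (u : V → ℝ) : Prop := ∃ C : ℝ, ∀ x, |u x| ≤ C

/-- The pairing `⟨u, v⟩ = ∑ₓ u(x) v(x) m(x)`. -/
noncomputable def pairing (m : V → ℝ) (u v : V → ℝ) : ℝ := ∑' x, u x * v x * m x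

/-- The space `ℓ²(V, m)` for a strictly positive `m`, as a space of functions on `V`
(absolute values make this a subspace for every `m`, and disappear for positive `m`). -/
def ellTwo (m : V → ℝ) : Submodule ℝ (V → ℝ) where
  carrier := {u | Summable fun x => u x ^ 2 * |m x|}
  zero_mem' := by simp [summable_zero]
  add_mem' := by
    intro u v hu hv
    have h : Summable fun x => 2 * (u x ^ 2 * |m x|) + 2 * (v x ^ 2 * |m x|) :=
      (Summable.mul_left 2 hu).add (Summable.mul_left 2 hv)
    refine Summable.of_nonneg_of_le (fun x => by positivity) (fun x => ?_) h
    have h1 : (u x + v x) ^ 2 ≤ 2 * u x ^ 2 + 2 * v x ^ 2 := by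
      nlinarith [sq_nonneg (u x - v x)]
    have h2 := mul_le_mul_of_nonneg_right h1 (abs_nonneg (m x))
    simp only [Pi.add_apply]
    linarith
  smul_mem' := by
    intro c u hu
    have h : Summable fun x => c ^ 2 * (u x ^ 2 * |m x|) := Summable.mul_left (c ^ 2) hu
    refine h.congr (fun x => ?_)
    simp only [Pi.smul_apply, smul_eq_mul]
    ring

open Classical in
/-- The function `δ_x`, equal to `1` at `x` and `0` elsewhere, as an element of `ℓ²(V, m)`. -/
noncomputable def deltaFun (m : V → ℝ) (x : V) : ellTwo m :=
  ⟨Pi.single x 1, by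
    refine summable_of_ne_finset_zero (s := {x}) (fun y hy => ?_)
    have h : y ≠ x := by simpa using hy
    simp [Pi.single_eq_of_ne h]⟩

end WeightedSequenceSpaces

namespace WeightedGraph

variable {V : Type*}

/-- `u ∈ D(Q^D)`: the closure of the finitely supported functions in `D̃ ∩ ℓ²(V, m)` with respect
to the form norm, whose square is `Q̃(u) + ‖u‖₂²`. -/
def MemFormDomain (G : WeightedGraph V) (m : V → ℝ) (u : V → ℝ) : Prop :=
  G.FiniteEnergy u ∧ u ∈ ellTwo m ∧
    ∀ ε : ℝ, 0 < ε → ∃ φ : V → ℝ, (Function.support φ).Finite ∧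
      Real.sqrt (G.form (u - φ) (u - φ) + pairing m (u - φ) (u - φ)) < ε

/-- `u ∈ D(L)` and `L u = w`, where `L` is the self-adjoint operator associated with `Q^D`:
`u ∈ D(Q^D)`, `w ∈ ℓ²(V, m)` and `Q^D(u, v) = ⟨w, v⟩` for all `v ∈ D(Q^D)`. -/
def IsOperatorValue (G : WeightedGraph V) (m : V → ℝ) (u w : ellTwo m) : Prop :=
  G.MemFormDomain m u ∧
    ∀ v : V → ℝ, G.MemFormDomain m v → G.form u v = pairing m w v

/-- `T` is the semigroup `(e^{-tL})_{t > 0}` associated with `Q^D`: the strongly continuous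
semigroup of self-adjoint contractions on `ℓ²(V, m)` whose generator is `-L`, with `L` the operator
associated with `Q^D`. Only the values `T t` with `t > 0` matter. -/
structure IsAssociatedSemigroup (G : WeightedGraph V) (m : V → ℝ)
    (T : ℝ → ellTwo m →ₗ[ℝ] ellTwo m) : Prop where
  symmetric : ∀ t, 0 < t → ∀ f g : ellTwo m, pairing m (T t f) g = pairing m f (T t g)
  semigroup : ∀ s t, 0 < s → 0 < t → T (s + t) = T s ∘ₗ T t
  contractive : ∀ t, 0 < t → ∀ f : ellTwo m, pairing m (T t f) (T t f) ≤ pairing m f f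
  strongly_continuous : ∀ f : ellTwo m,
    Tendsto (fun t => pairing m (T t f - f : ellTwo m) (T t f - f : ellTwo m)) (𝓝[>] 0) (𝓝 0)
  generator : ∀ u w : ellTwo m,
    Tendsto (fun t : ℝ => pairing m (t⁻¹ • (u - T t u) - w : ellTwo m)
      (t⁻¹ • (u - T t u) - w : ellTwo m)) (𝓝[>] 0) (𝓝 0) ↔ G.IsOperatorValue m u w

/-- `Q^D` is recurrent: `∫₀^∞ (e^{-tL} δ_x)(y) dt = ∞` for all `x`, `y`
(the integrand is nonnegative, and `e^{-tL}` is unique). -/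
def IsRecurrent (G : WeightedGraph V) (m : V → ℝ) : Prop :=
  ∃ T : ℝ → ellTwo m →ₗ[ℝ] ellTwo m, G.IsAssociatedSemigroup m T ∧
    ∀ x y : V,
      ∫⁻ t in Set.Ioi (0 : ℝ), ENNReal.ofReal ((T t (deltaFun m x) : V → ℝ) y) = ⊤

/-- `D_∞ = D̃ ∩ ℓ^∞(V)`. -/
def DInfty (G : WeightedGraph V) : Set (V → ℝ) :=
  {u | G.FiniteEnergy u ∧ MemEllInfty u}

/-- `D¹`, the functions `v` of finite energy with `L̃ v ∈ ℓ¹(V, m)`. -/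
def DOne (G : WeightedGraph V) (m : V → ℝ) : Set (V → ℝ) :=
  {v | G.FiniteEnergy v ∧ MemEllOne m (G.laplacian m v)}

/-- The boundary term `R(u, v) = Q̃(u, v) - ⟨u, L̃ v⟩`. -/
noncomputable def boundaryTerm (G : WeightedGraph V) (m : V → ℝ) (u v : V → ℝ) : ℝ :=
  G.form u v - pairing m u (G.laplacian m v)

end WeightedGraph

/-!
Both conditions are equivalent to the vanishing of the capacity of the vertices
(`WeightedGraph.NullCapacity`): for every `ε > 0` there is a finitely supported `φ` with `φ o = 1`
and energy less than `ε`.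

*Boundary term and capacity.* If the capacity of `o` vanishes, then connectedness and truncation
give finitely supported `0 ≤ φ n ≤ 1` tending to `1` pointwise with energy tending to zero. Green's
formula holds for `u * φ n`, and both of its sides converge, which gives `R(u, v) = 0`
(`NullCapacity.boundaryTerm_eq_zero`). If the capacity of `o` is positive, then the equilibrium
potential `v` of `o` has finite energy and `L̃ v` is a nonzero multiple of `δ_o`, so that
`R(1, v) ≠ 0` (`exists_laplacian_eq_single`, `nullCapacity_of_boundaryTerm_eq_zero`).

*Recurrence and capacity.* Let `u s = ∫₀ˢ e^{-tL} δ_o dt`. Then `L (u s) = δ_o - e^{-sL} δ_o`, and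
consequently `Q(u s) ≤ m o * u s o`. If the capacity of `o` is positive, then
`ε * u s o ^ 2 ≤ Q(u s)`, so `u s o` stays bounded (`IsAssociatedSemigroup.nullCapacity`). If
`u s o` stays bounded, then `e^{-sL} δ_o → 0`, and testing the equation for `u s` with a function
`φ` of small energy shows that the capacity is positive (`exists_lt_integratedOrbit`). By connectedness
`(u s o - u s y) ^ 2 ≤ C * Q(u s) ≤ C * m o * u s o`, which takes care of the off-diagonal integrals
(`setLIntegral_eq_top`). Positivity of the heat kernel off the diagonal plays no role, because
`ENNReal.ofReal` takes the positive part.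

*Existence of the semigroup.* The resolvent `A = (1 + L)⁻¹` is the compression to `ℓ²(V)` of the
orthogonal projection to the closed graph of the discrete gradient in `ℓ²(V) × ℓ²(V × V)`
(`resolvent`, `isOperatorValue_iff`). The function `s ↦ exp (-t (1 / s - 1))` is continuous on
`[0, 1]` for `t > 0`, so `e^{-tL}` is obtained from the continuous functional calculus of the
bounded operator `A`, after complexification (`RealStructure.exists_semigroup`).
-/

/-! ### The Hilbert space `ℓ²(V, m)`, the gradient and Green's formula -/

section WeightedSequenceSpaces

variable {V : Type*}

theorem memℓp_two_iff_summable_sq {ι : Type*} {f : ι → ℝ} :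
    Memℓp f 2 ↔ Summable fun i => f i ^ 2 := by
  rw [memℓp_gen_iff (by norm_num)]
  simp

theorem mem_ellTwo_iff {m : V → ℝ} (hm : ∀ x, 0 < m x) {u : V → ℝ} :
    u ∈ ellTwo m ↔ Summable fun x => (u x * √(m x)) ^ 2 := by
  have h : (fun x => (u x * √(m x)) ^ 2) = fun x => u x ^ 2 * |m x| := by
    funext x
    rw [mul_pow, Real.sq_sqrt (hm x).le, abs_of_pos (hm x)]
  rw [h]
  rfl

/-- The unitary identification `u ↦ u √m` of `ℓ²(V, m)` with the Hilbert space `ℓ²(V)`. -/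
noncomputable def toL2 (m : V → ℝ) (hm : ∀ x, 0 < m x) :
    ellTwo m ≃ₗ[ℝ] lp (fun _ : V => ℝ) 2 where
  toFun u := ⟨fun x => (u : V → ℝ) x * √(m x),
    memℓp_two_iff_summable_sq.2 ((mem_ellTwo_iff hm).1 u.2)⟩
  map_add' u v := by
    ext x
    exact add_mul _ _ _
  map_smul' c u := by
    ext x
    exact mul_assoc _ _ _
  invFun f := ⟨fun x => f x / √(m x), by
    rw [mem_ellTwo_iff hm]
    refine (memℓp_two_iff_summable_sq.1 f.2).congr fun x => ?_
    rw [div_mul_cancel₀ _ (Real.sqrt_pos.2 (hm x)).ne']⟩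
  left_inv u := by
    ext x
    exact mul_div_cancel_right₀ _ (Real.sqrt_pos.2 (hm x)).ne'
  right_inv f := by
    ext x
    exact div_mul_cancel₀ _ (Real.sqrt_pos.2 (hm x)).ne'

theorem toL2_apply (m : V → ℝ) (hm : ∀ x, 0 < m x) (u : ellTwo m) (x : V) :
    toL2 m hm u x = (u : V → ℝ) x * √(m x) := rfl

theorem toL2_symm_apply (m : V → ℝ) (hm : ∀ x, 0 < m x) (f : lp (fun _ : V => ℝ) 2) (x : V) :
    ((toL2 m hm).symm f : V → ℝ) x = f x / √(m x) := rfl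

theorem pairing_eq_inner {m : V → ℝ} (hm : ∀ x, 0 < m x) (u v : ellTwo m) :
    pairing m u v = inner ℝ (toL2 m hm u) (toL2 m hm v) := by
  rw [lp.inner_eq_tsum]
  refine tsum_congr fun x => ?_
  rw [toL2_apply, toL2_apply, RCLike.inner_apply, conj_trivial]
  linear_combination -((u : V → ℝ) x * (v : V → ℝ) x) * Real.mul_self_sqrt (hm x).le

theorem pairing_self_eq_norm_sq {m : V → ℝ} (hm : ∀ x, 0 < m x) (u : ellTwo m) :
    pairing m u u = ‖toL2 m hm u‖ ^ 2 := by
  rw [pairing_eq_inner hm, real_inner_self_eq_norm_sq]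

theorem pairing_deltaFun_left (m : V → ℝ) (x : V) (u : V → ℝ) :
    pairing m (deltaFun m x) u = u x * m x := by
  classical
  rw [pairing, tsum_eq_single x]
  · simp [deltaFun]
  · intro y hy
    simp [deltaFun, Pi.single_eq_of_ne hy]

theorem mem_ellTwo_of_finite_support (m : V → ℝ) {φ : V → ℝ}
    (h : (Function.support φ).Finite) : φ ∈ ellTwo m := by
  refine summable_of_ne_finset_zero (s := h.toFinset) fun x hx => ?_
  have : φ x = 0 := by simpa using hx
  simp [this]

/-- Evaluation at a vertex as the inner product with a multiple of a delta function. -/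
theorem inner_toL2_deltaFun {m : V → ℝ} (hm : ∀ x, 0 < m x) (x : V) (u : ellTwo m) :
    inner ℝ (toL2 m hm (deltaFun m x)) (toL2 m hm u) = (u : V → ℝ) x * m x := by
  rw [← pairing_eq_inner hm, pairing_deltaFun_left]

end WeightedSequenceSpaces

namespace WeightedGraph

variable {V : Type*} (G : WeightedGraph V)

theorem finiteEnergy_iff_summable_sq {u : V → ℝ} :
    G.FiniteEnergy u ↔
      Summable fun p : V × V => (√(G.b p.1 p.2 / 2) * (u p.1 - u p.2)) ^ 2 := by
  have h : (fun p : V × V => (√(G.b p.1 p.2 / 2) * (u p.1 - u p.2)) ^ 2) =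
      fun p : V × V => 2⁻¹ * (G.b p.1 p.2 * (u p.1 - u p.2) ^ 2) := by
    funext p
    rw [mul_pow, Real.sq_sqrt (div_nonneg (G.b_nonneg _ _) zero_le_two)]
    ring
  rw [h, summable_mul_left_iff (by norm_num)]
  rfl

/-- The space `D̃` of functions of finite energy, as a submodule. -/
def energySpace : Submodule ℝ (V → ℝ) where
  carrier := {u | G.FiniteEnergy u}
  zero_mem' := by simp [FiniteEnergy, summable_zero]
  add_mem' := by
    intro u v hu hv
    change G.FiniteEnergy (u + v)
    have hu' := memℓp_two_iff_summable_sq.2 (G.finiteEnergy_iff_summable_sq.1 hu)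
    have hv' := memℓp_two_iff_summable_sq.2 (G.finiteEnergy_iff_summable_sq.1 hv)
    refine G.finiteEnergy_iff_summable_sq.2
      ((memℓp_two_iff_summable_sq.1 (hu'.add hv')).congr fun p => ?_)
    simp only [Pi.add_apply]
    ring
  smul_mem' := by
    intro c u hu
    change G.FiniteEnergy (c • u)
    refine (Summable.mul_left (c ^ 2) hu).congr fun p => ?_
    simp only [Pi.smul_apply, smul_eq_mul]
    ring

theorem mem_energySpace {u : V → ℝ} : u ∈ G.energySpace ↔ G.FiniteEnergy u := Iff.rfl

/-- The weighted discrete gradient `(x, y) ↦ √(b(x, y) / 2) (u x - u y)`, normalised so that the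
energy form is the inner product of gradients in `ℓ²(V × V)`. -/
noncomputable def gradient : G.energySpace →ₗ[ℝ] lp (fun _ : V × V => ℝ) 2 where
  toFun u := ⟨fun p => √(G.b p.1 p.2 / 2) * ((u : V → ℝ) p.1 - (u : V → ℝ) p.2),
    memℓp_two_iff_summable_sq.2 (G.finiteEnergy_iff_summable_sq.1 u.2)⟩
  map_add' u v := by
    ext p
    change √(G.b p.1 p.2 / 2) * ((u : V → ℝ) p.1 + (v : V → ℝ) p.1
      - ((u : V → ℝ) p.2 + (v : V → ℝ) p.2)) = _ * _ + _ * _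
    ring
  map_smul' c u := by
    ext p
    change √(G.b p.1 p.2 / 2) * (c * (u : V → ℝ) p.1 - c * (u : V → ℝ) p.2) = c * (_ * _)
    ring

theorem gradient_apply (u : G.energySpace) (p : V × V) :
    G.gradient u p = √(G.b p.1 p.2 / 2) * ((u : V → ℝ) p.1 - (u : V → ℝ) p.2) := rfl

theorem form_eq_inner (u v : G.energySpace) :
    G.form u v = inner ℝ (G.gradient u) (G.gradient v) := by
  rw [lp.inner_eq_tsum, form, ← tsum_mul_left]
  refine tsum_congr fun p => ?_
  rw [gradient_apply, gradient_apply, RCLike.inner_apply, conj_trivial]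
  have h := Real.mul_self_sqrt (div_nonneg (G.b_nonneg p.1 p.2) zero_le_two)
  linear_combination -(((u : V → ℝ) p.1 - (u : V → ℝ) p.2) *
    ((v : V → ℝ) p.1 - (v : V → ℝ) p.2)) * h

theorem form_self_eq_norm_sq (u : G.energySpace) : G.form u u = ‖G.gradient u‖ ^ 2 := by
  rw [form_eq_inner, real_inner_self_eq_norm_sq]

theorem form_self_nonneg {u : V → ℝ} : 0 ≤ G.form u u := by
  refine mul_nonneg (by norm_num) (tsum_nonneg fun p => ?_)
  rw [mul_assoc]
  exact mul_nonneg (G.b_nonneg _ _) (mul_self_nonneg _)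

theorem FiniteEnergy.summable_form {G : WeightedGraph V} {u v : V → ℝ} (hu : G.FiniteEnergy u)
    (hv : G.FiniteEnergy v) :
    Summable fun p : V × V => G.b p.1 p.2 * (u p.1 - u p.2) * (v p.1 - v p.2) := by
  have h := (lp.summable_inner (𝕜 := ℝ) (G.gradient ⟨u, hu⟩) (G.gradient ⟨v, hv⟩)).mul_left 2
  refine h.congr fun p => ?_
  rw [gradient_apply, gradient_apply, RCLike.inner_apply, conj_trivial]
  have h := Real.mul_self_sqrt (div_nonneg (G.b_nonneg p.1 p.2) zero_le_two)
  linear_combination 2 * ((u p.1 - u p.2) * (v p.1 - v p.2)) * h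

theorem finiteEnergy_of_finite_support {φ : V → ℝ} (h : (Function.support φ).Finite) :
    G.FiniteEnergy φ := by
  have key : Summable fun p : V × V => G.b p.1 p.2 * φ p.1 ^ 2 := by
    refine (summable_prod_of_nonneg
      fun p => mul_nonneg (G.b_nonneg p.1 p.2) (sq_nonneg (φ p.1))).2 ⟨fun x => ?_, ?_⟩
    · exact (G.b_summable x).mul_right (φ x ^ 2)
    refine summable_of_ne_finset_zero (s := h.toFinset) fun x hx => ?_
    have : φ x = 0 := by simpa using hx
    simp [this]
  have key' : Summable fun p : V × V => G.b p.1 p.2 * φ p.2 ^ 2 := by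
    refine ((Equiv.prodComm V V).summable_iff.2 key).congr fun p => ?_
    simp [G.b_symm p.1 p.2]
  refine Summable.of_nonneg_of_le (fun p => mul_nonneg (G.b_nonneg _ _) (sq_nonneg _))
    (fun p => ?_) ((key.add key').mul_left 2)
  nlinarith [mul_nonneg (G.b_nonneg p.1 p.2) (sq_nonneg (φ p.1 + φ p.2))]

/-- Along an edge, the increment of a function is controlled by its energy; hence, in a connected
graph, so is the increment between any two vertices. -/
theorem Connected.exists_sq_sub_le {G : WeightedGraph V} (hG : G.Connected) (x y : V) :
    ∃ C : ℝ, 0 ≤ C ∧ ∀ u : V → ℝ, G.FiniteEnergy u → (u x - u y) ^ 2 ≤ C * G.form u u := by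
  induction hG x y with
  | refl => exact ⟨0, le_rfl, fun u _ => by simp⟩
  | @tail z w _ hzw ih =>
    obtain ⟨C, hC, h⟩ := ih
    refine ⟨2 * C + 2 * (2 / G.b z w), by positivity, fun u hu => ?_⟩
    have hedge : (u z - u w) ^ 2 ≤ 2 / G.b z w * G.form u u := by
      have h1 : G.b z w * (u z - u w) ^ 2 ≤
          ∑' p : V × V, G.b p.1 p.2 * (u p.1 - u p.2) ^ 2 :=
        hu.le_tsum (z, w) fun p _ => mul_nonneg (G.b_nonneg _ _) (sq_nonneg _)
      have h2 : G.form u u = 1 / 2 * ∑' p : V × V, G.b p.1 p.2 * (u p.1 - u p.2) ^ 2 := by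
        rw [form]
        congr 1
        exact tsum_congr fun p => by ring
      rw [div_mul_eq_mul_div, le_div_iff₀ hzw]
      linarith
    have := h u hu
    nlinarith [sq_nonneg ((u x - u z) - (u z - u w))]

/-- The gradient is closed with respect to pointwise convergence. -/
theorem exists_gradient_eq_of_tendsto {φ : ℕ → G.energySpace} {v : V → ℝ}
    {e : lp (fun _ : V × V => ℝ) 2} (hφ : ∀ x, Tendsto (fun n => (φ n : V → ℝ) x) atTop (𝓝 (v x)))
    (he : Tendsto (fun n => G.gradient (φ n)) atTop (𝓝 e)) :
    ∃ hv : v ∈ G.energySpace, G.gradient ⟨v, hv⟩ = e := by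
  have hp : ∀ p : V × V, e p = √(G.b p.1 p.2 / 2) * (v p.1 - v p.2) := fun p =>
    tendsto_nhds_unique
      (((lp.evalCLM ℝ (fun _ : V × V => ℝ) 2 p).continuous.tendsto e).comp he)
      (((hφ p.1).sub (hφ p.2)).const_mul _)
  have hv : v ∈ G.energySpace := by
    rw [mem_energySpace, finiteEnergy_iff_summable_sq]
    exact (memℓp_two_iff_summable_sq.1 e.2).congr fun p => by rw [hp]
  refine ⟨hv, ?_⟩
  ext p
  rw [hp]
  rfl

/-- The sums defining the formal Laplacian converge on functions of finite energy. -/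
theorem FiniteEnergy.summable_laplacian {G : WeightedGraph V} {v : V → ℝ} (hv : G.FiniteEnergy v)
    (x : V) : Summable fun y => G.b x y * (v x - v y) := by
  have h1 : Summable fun y => G.b x y * (v x - v y) ^ 2 :=
    hv.comp_injective (Prod.mk_right_injective x)
  refine Summable.of_norm_bounded ((G.b_summable x).add h1) fun y => ?_
  rw [norm_mul, Real.norm_of_nonneg (G.b_nonneg x y), Real.norm_eq_abs]
  have : |v x - v y| ≤ 1 + (v x - v y) ^ 2 := by
    rw [abs_le]
    constructor <;> nlinarith [sq_nonneg (v x - v y - 1), sq_nonneg (v x - v y + 1)]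
  nlinarith [mul_le_mul_of_nonneg_left this (G.b_nonneg x y)]

/-- Green's formula. -/
theorem form_eq_pairing_laplacian {m : V → ℝ} (hm : ∀ x, 0 < m x) {φ v : V → ℝ}
    (hφ : (Function.support φ).Finite) (hv : G.FiniteEnergy v) :
    G.form φ v = pairing m φ (G.laplacian m v) := by
  set F : V × V → ℝ := fun p => φ p.1 * (G.b p.1 p.2 * (v p.1 - v p.2)) with hF
  have hs : Summable F := by
    rw [← summable_abs_iff, summable_prod_of_nonneg fun p => abs_nonneg _]
    refine ⟨fun x => ((hv.summable_laplacian x).mul_left (φ x)).abs,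
      summable_of_ne_finset_zero (s := hφ.toFinset) fun x hx => ?_⟩
    have : φ x = 0 := by simpa using hx
    simp [hF, this]
  have hs' : Summable fun p : V × V => F p.swap := (Equiv.prodComm V V).summable_iff.2 hs
  have h1 : G.form φ v = ∑' p, F p := by
    have h2 : ∑' p : V × V, F p.swap = ∑' p, F p := (Equiv.prodComm V V).tsum_eq F
    have h3 : ∑' p : V × V, G.b p.1 p.2 * (φ p.1 - φ p.2) * (v p.1 - v p.2) =
        ∑' p, F p + ∑' p : V × V, F p.swap := by
      rw [← hs.tsum_add hs']
      refine tsum_congr fun p => ?_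
      simp only [hF, Prod.fst_swap, Prod.snd_swap, G.b_symm p.2 p.1]
      ring
    rw [form, h3, h2]
    ring
  rw [h1, hs.tsum_prod, pairing]
  refine tsum_congr fun x => ?_
  simp only [hF, tsum_mul_left, laplacian]
  have := (hm x).ne'
  field_simp

end WeightedGraph

/-! ### Capacity and the boundary term -/

namespace WeightedGraph

variable {V : Type*} (G : WeightedGraph V)

/-- The capacity of the vertex `o`, i.e. the infimum of the energies of the finitely supported
functions equal to `1` at `o`, vanishes. -/
def NullCapacity (o : V) : Prop :=
  ∀ ε : ℝ, 0 < ε → ∃ φ : V → ℝ, (Function.support φ).Finite ∧ φ o = 1 ∧ G.form φ φ < ε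

theorem form_self_eq (u : V → ℝ) :
    G.form u u = 1 / 2 * ∑' p : V × V, G.b p.1 p.2 * (u p.1 - u p.2) ^ 2 := by
  rw [form]
  congr 1
  exact tsum_congr fun p => by ring

/-- Normal contractions do not increase the energy. -/
theorem form_self_le_of_contraction {u v : V → ℝ} (hu : G.FiniteEnergy u)
    (h : ∀ x y, |v x - v y| ≤ |u x - u y|) : G.form v v ≤ G.form u u := by
  have h' : ∀ p : V × V, G.b p.1 p.2 * (v p.1 - v p.2) ^ 2 ≤ G.b p.1 p.2 * (u p.1 - u p.2) ^ 2 :=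
    fun p => mul_le_mul_of_nonneg_left (sq_le_sq.2 (h p.1 p.2)) (G.b_nonneg _ _)
  have hv : G.FiniteEnergy v := Summable.of_nonneg_of_le
    (fun p => mul_nonneg (G.b_nonneg _ _) (sq_nonneg _)) h' hu
  rw [form_self_eq, form_self_eq]
  exact mul_le_mul_of_nonneg_left (Summable.tsum_le_tsum h' hv hu) (by norm_num)

/-- If a vertex has capacity zero, then the constant function `1` is a limit, pointwise and in
energy, of finitely supported functions with values in `[0, 1]`. -/
theorem NullCapacity.exists_cutoff {G : WeightedGraph V} (hG : G.Connected) {o : V}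
    (ho : G.NullCapacity o) :
    ∃ φ : ℕ → V → ℝ, (∀ n, (Function.support (φ n)).Finite) ∧ (∀ n x, |φ n x| ≤ 1) ∧
      Tendsto (fun n => G.form (φ n) (φ n)) atTop (𝓝 0) ∧
      ∀ x, Tendsto (fun n => φ n x) atTop (𝓝 1) := by
  choose ψ hψ hψo hψε using fun n : ℕ => ho (1 / ((n : ℝ) + 1)) (by positivity)
  let φ : ℕ → V → ℝ := fun n x => max 0 (min (ψ n x) 1)
  have hfin : ∀ n, (Function.support (φ n)).Finite := fun n => by
    refine (hψ n).subset fun x hx hx' => hx ?_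
    simp [φ, hx']
  have hle : ∀ n, G.form (φ n) (φ n) ≤ 1 / ((n : ℝ) + 1) := fun n => by
    refine (G.form_self_le_of_contraction (G.finiteEnergy_of_finite_support (hψ n))
      fun x y => ?_).trans (hψε n).le
    refine (abs_max_sub_max_le_max _ _ _ _).trans ?_
    rw [sub_self, abs_zero, max_eq_right (abs_nonneg _)]
    refine (abs_min_sub_min_le_max _ _ _ _).trans ?_
    rw [sub_self, abs_zero, max_eq_left (abs_nonneg _)]
  have hlim : Tendsto (fun n => G.form (φ n) (φ n)) atTop (𝓝 0) :=
    squeeze_zero (fun n => G.form_self_nonneg) hle tendsto_one_div_add_atTop_nhds_zero_nat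
  refine ⟨φ, hfin, fun n x => ?_, hlim, fun x => ?_⟩
  · rw [abs_of_nonneg (le_max_left _ _)]
    exact max_le zero_le_one (min_le_right _ _)
  · obtain ⟨C, -, hC⟩ := hG.exists_sq_sub_le x o
    have h1 : Tendsto (fun n => (φ n x - 1) ^ 2) atTop (𝓝 0) := by
      refine squeeze_zero (fun n => sq_nonneg _) (fun n => ?_) (by simpa using hlim.const_mul C)
      have h2 := hC (φ n) (G.finiteEnergy_of_finite_support (hfin n))
      have h3 : φ n o = 1 := by simp [φ, hψo]
      rwa [h3] at h2
    have h2 := h1.sqrt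
    simp only [Real.sqrt_sq_eq_abs, Real.sqrt_zero] at h2
    simpa using (tendsto_zero_iff_abs_tendsto_zero _).2 h2 |>.add_const 1

/-- Multiplying by the cut-off functions approximates the energy form. The product rule
`(uφ) x - (uφ) y = u x (φ x - φ y) + φ y (u x - u y)` gives a term that vanishes because the energy
of the cut-offs does, and a term to which dominated convergence applies. -/
theorem tendsto_form_mul {u v : V → ℝ} (hu : G.FiniteEnergy u) (hub : MemEllInfty u)
    (hv : G.FiniteEnergy v) {φ : ℕ → V → ℝ} (hfin : ∀ n, (Function.support (φ n)).Finite)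
    (hφ : ∀ n x, |φ n x| ≤ 1) (hE : Tendsto (fun n => G.form (φ n) (φ n)) atTop (𝓝 0))
    (hlim : ∀ x, Tendsto (fun n => φ n x) atTop (𝓝 1)) :
    Tendsto (fun n => G.form (u * φ n) v) atTop (𝓝 (G.form u v)) := by
  obtain ⟨C, hC⟩ := hub
  let dφ : ℕ → lp (fun _ : V × V => ℝ) 2 := fun n =>
    G.gradient ⟨φ n, G.finiteEnergy_of_finite_support (hfin n)⟩
  have hdφ : Tendsto dφ atTop (𝓝 0) := by
    rw [tendsto_zero_iff_norm_tendsto_zero]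
    have := hE.sqrt
    rw [Real.sqrt_zero] at this
    refine this.congr fun n => ?_
    rw [← Real.sqrt_sq (norm_nonneg (dφ n)), ← form_self_eq_norm_sq]
  let g : lp (fun _ : V × V => ℝ) 2 := ⟨fun p => u p.1 * G.gradient ⟨v, hv⟩ p, by
    refine memℓp_two_iff_summable_sq.2 (Summable.of_nonneg_of_le (fun p => sq_nonneg _)
      (fun p => ?_) ((memℓp_two_iff_summable_sq.1 (G.gradient ⟨v, hv⟩).2).mul_left (C ^ 2)))
    rw [mul_pow]
    exact mul_le_mul_of_nonneg_right (sq_le_sq.2 ((hC _).trans (le_abs_self C))) (sq_nonneg _)⟩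
  have h1 : Tendsto (fun n => inner ℝ (dφ n) g) atTop (𝓝 0) := by
    simpa using hdφ.inner (tendsto_const_nhds (x := g))
  have hs := hu.summable_form hv
  have hbd : ∀ n (p : V × V), ‖φ n p.2 * (G.b p.1 p.2 * (u p.1 - u p.2) * (v p.1 - v p.2))‖ ≤
      ‖G.b p.1 p.2 * (u p.1 - u p.2) * (v p.1 - v p.2)‖ := fun n p => by
    rw [norm_mul]
    exact mul_le_of_le_one_left (norm_nonneg _) (hφ n p.2)
  have h2 : Tendsto
      (fun n => ∑' p : V × V, φ n p.2 * (G.b p.1 p.2 * (u p.1 - u p.2) * (v p.1 - v p.2))) atTop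
      (𝓝 (∑' p : V × V, G.b p.1 p.2 * (u p.1 - u p.2) * (v p.1 - v p.2))) := by
    refine tendsto_tsum_of_dominated_convergence hs.norm (fun p => ?_) (Eventually.of_forall hbd)
    simpa using (hlim p.2).mul_const (G.b p.1 p.2 * (u p.1 - u p.2) * (v p.1 - v p.2))
  have h3 := h1.add (h2.const_mul (1 / 2))
  rw [zero_add] at h3
  refine h3.congr fun n => ?_
  rw [lp.inner_eq_tsum, form, ← tsum_mul_left, ← tsum_mul_left, ← Summable.tsum_add]
  · refine tsum_congr fun p => ?_
    rw [RCLike.inner_apply, conj_trivial]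
    change u p.1 * (√(G.b p.1 p.2 / 2) * (v p.1 - v p.2)) *
      (√(G.b p.1 p.2 / 2) * (φ n p.1 - φ n p.2)) + _ = _
    have h := Real.mul_self_sqrt (div_nonneg (G.b_nonneg p.1 p.2) zero_le_two)
    simp only [Pi.mul_apply]
    linear_combination (u p.1 * (v p.1 - v p.2) * (φ n p.1 - φ n p.2)) * h
  · exact lp.summable_inner _ _
  · exact (Summable.of_norm_bounded hs.norm (hbd n)).mul_left _

theorem NullCapacity.boundaryTerm_eq_zero {G : WeightedGraph V} (hG : G.Connected) {o : V}
    (ho : G.NullCapacity o) {m : V → ℝ} (hm : ∀ x, 0 < m x) {u v : V → ℝ} (hu : u ∈ G.DInfty)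
    (hv : v ∈ G.DOne m) : G.boundaryTerm m u v = 0 := by
  obtain ⟨φ, hfin, hφ, hE, hlim⟩ := ho.exists_cutoff hG
  have h1 := G.tendsto_form_mul hu.1 hu.2 hv.1 hfin hφ hE hlim
  have h2 : Tendsto (fun n => pairing m (u * φ n) (G.laplacian m v)) atTop
      (𝓝 (pairing m u (G.laplacian m v))) := by
    obtain ⟨C, hC⟩ := hu.2
    refine tendsto_tsum_of_dominated_convergence (hv.2.mul_left C) (fun x => ?_)
      (Eventually.of_forall fun n x => ?_)
    · simpa using (((hlim x).const_mul (u x)).mul_const (G.laplacian m v x)).mul_const (m x)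
    · rw [Pi.mul_apply, norm_mul, norm_mul, norm_mul, Real.norm_of_nonneg (hm x).le, ← mul_assoc]
      refine mul_le_mul_of_nonneg_right (mul_le_mul_of_nonneg_right ?_ (norm_nonneg _)) (hm x).le
      calc ‖u x‖ * ‖φ n x‖ ≤ ‖u x‖ * 1 := mul_le_mul_of_nonneg_left (hφ n x) (norm_nonneg _)
        _ ≤ C := by simpa using hC x
  have h3 : ∀ n, G.form (u * φ n) v = pairing m (u * φ n) (G.laplacian m v) := fun n =>
    G.form_eq_pairing_laplacian hm ((hfin n).subset fun x hx hx' => hx (by simp [hx'])) hv.1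
  rw [boundaryTerm, sub_eq_zero]
  exact tendsto_nhds_unique h1 (h2.congr fun n => (h3 n).symm)

/-- Finitely supported functions, as functions of finite energy. -/
def finSupp : Submodule ℝ G.energySpace where
  carrier := {φ | (Function.support (φ : V → ℝ)).Finite}
  zero_mem' := by simp
  add_mem' {φ ψ} hφ hψ := (hφ.union hψ).subset (Function.support_add (φ : V → ℝ) ψ)
  smul_mem' c φ hφ := hφ.subset (Function.support_const_smul_subset c (φ : V → ℝ))

/-- If the capacity of `o` is positive, then there is a function `v` of finite energy (the
equilibrium potential of `o`) with `L̃ v` a nonzero multiple of `δ_o`. Its gradient is the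
component of the gradient of `1_o` orthogonal to the gradients of the finitely supported functions
vanishing at `o`. -/
theorem exists_laplacian_eq_single {G : WeightedGraph V} (hG : G.Connected) {o : V}
    (ho : ¬ G.NullCapacity o) {m : V → ℝ} (hm : ∀ x, 0 < m x) :
    ∃ v : V → ℝ, G.FiniteEnergy v ∧ G.laplacian m v o ≠ 0 ∧
      ∀ x, x ≠ o → G.laplacian m v x = 0 := by
  classical
  have hδ : ∀ x : V, (Function.support (Pi.single x (1 : ℝ) : V → ℝ)).Finite := fun x =>
    (Set.finite_singleton x).subset (Pi.support_single_subset)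
  let δ : V → G.energySpace := fun x => ⟨Pi.single x 1, G.finiteEnergy_of_finite_support (hδ x)⟩
  let Z₀ : Submodule ℝ G.energySpace :=
    G.finSupp ⊓ LinearMap.ker ((LinearMap.proj o : (V → ℝ) →ₗ[ℝ] ℝ) ∘ₗ G.energySpace.subtype)
  let Z : Submodule ℝ (lp (fun _ : V × V => ℝ) 2) := (Z₀.map G.gradient).topologicalClosure
  have : CompleteSpace Z := (Z₀.map G.gradient).isClosed_topologicalClosure.completeSpace_coe
  set e := G.gradient (δ o) - Z.starProjection (G.gradient (δ o)) with he
  have hperp : ∀ φ ∈ Z₀, inner ℝ e (G.gradient φ) = 0 := fun φ hφ =>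
    Z.starProjection_inner_eq_zero _ _
      ((Z₀.map G.gradient).le_topologicalClosure (Submodule.mem_map_of_mem hφ))
  -- a sequence of finitely supported functions, equal to `1` at `o`, whose gradients tend to `e`
  obtain ⟨ζ, hζ, hζlim⟩ : ∃ ζ : ℕ → G.energySpace, (∀ n, ζ n ∈ Z₀) ∧
      Tendsto (fun n => G.gradient (ζ n)) atTop (𝓝 (Z.starProjection (G.gradient (δ o)))) := by
    have hmem : Z.starProjection (G.gradient (δ o)) ∈ closure (Z₀.map G.gradient : Set _) :=
      Z.starProjection_apply_mem _
    obtain ⟨z, hz, hzlim⟩ := mem_closure_iff_seq_limit.1 hmem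
    choose ζ hζ hζz using hz
    exact ⟨ζ, hζ, by simpa only [hζz] using hzlim⟩
  let φ : ℕ → G.energySpace := fun n => δ o - ζ n
  have hφo : ∀ n, (φ n : V → ℝ) o = 1 := fun n => by
    have h : (ζ n : V → ℝ) o = 0 := (hζ n).2
    simp [φ, δ, h]
  have hφfin : ∀ n, (Function.support (φ n : V → ℝ)).Finite := fun n =>
    G.finSupp.sub_mem (hδ o) (hζ n).1
  have hφlim : Tendsto (fun n => G.gradient (φ n)) atTop (𝓝 e) := by
    simpa only [φ, map_sub] using tendsto_const_nhds.sub hζlim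
  have hene : e ≠ 0 := by
    rintro h0
    rw [h0] at hφlim
    refine ho fun ε hε => ?_
    have h := (hφlim.norm.pow 2).eventually_lt_const (u := ε) (by simpa using hε)
    obtain ⟨n, hn⟩ := h.exists
    exact ⟨φ n, hφfin n, hφo n, by rwa [form_self_eq_norm_sq]⟩
  have hcauchy : ∀ x, ∃ a, Tendsto (fun n => (φ n : V → ℝ) x) atTop (𝓝 a) := fun x => by
    refine cauchySeq_tendsto_of_complete ?_
    obtain ⟨C, hC, hCx⟩ := hG.exists_sq_sub_le x o
    rw [Metric.cauchySeq_iff]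
    intro ε hε
    obtain ⟨N, hN⟩ := Metric.cauchySeq_iff.1 hφlim.cauchySeq (ε / √(C + 1)) (by positivity)
    refine ⟨N, fun k hk l hl => ?_⟩
    have h1 := hCx (φ k - φ l : G.energySpace) (φ k - φ l).2
    rw [form_self_eq_norm_sq, map_sub, ← dist_eq_norm] at h1
    have h2 : ((φ k - φ l : G.energySpace) : V → ℝ) x - ((φ k - φ l : G.energySpace) : V → ℝ) o =
        (φ k : V → ℝ) x - (φ l : V → ℝ) x := by
      have h3 := hφo k
      have h4 := hφo l
      simp only [Submodule.coe_sub, Pi.sub_apply]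
      linarith
    rw [h2] at h1
    rw [Real.dist_eq]
    refine abs_lt_of_sq_lt_sq (h1.trans_lt ?_) hε.le
    have h5 := hN k hk l hl
    rw [lt_div_iff₀ (by positivity)] at h5
    have h6 := pow_lt_pow_left₀ h5 (by positivity) two_ne_zero
    rw [mul_pow, Real.sq_sqrt (by positivity)] at h6
    nlinarith [sq_nonneg (dist (G.gradient (φ k)) (G.gradient (φ l)))]
  choose v hvlim using hcauchy
  obtain ⟨hv, hve⟩ := G.exists_gradient_eq_of_tendsto hvlim hφlim
  have hlap : ∀ x, inner ℝ e (G.gradient (δ x)) = m x * G.laplacian m v x := fun x => by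
    have h := G.form_eq_pairing_laplacian hm (hδ x) hv
    rw [real_inner_comm, ← hve, ← form_eq_inner]
    change G.form (Pi.single x 1) v = _
    rw [h, pairing, tsum_eq_single x]
    · simp [mul_comm]
    · intro y hy
      simp [hy]
  refine ⟨v, hv, fun h => hene ?_, fun x hx => ?_⟩
  · have h1 := hlap o
    rw [h, mul_zero] at h1
    have h2 : ∀ n, inner ℝ e (G.gradient (φ n)) = 0 := fun n => by
      rw [map_sub, inner_sub_right, h1, hperp _ (hζ n), sub_zero]
    have h3 := (tendsto_const_nhds (x := e)).inner (𝕜 := ℝ) hφlim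
    simp only [h2] at h3
    exact inner_self_eq_zero.1 (tendsto_nhds_unique h3 tendsto_const_nhds)
  · have h1 := hlap x
    rw [hperp (δ x) ⟨hδ x, by simp [δ, hx.symm]⟩] at h1
    exact (mul_eq_zero.1 h1.symm).resolve_left (hm x).ne'

/-- If the boundary term vanishes, then all capacities do: otherwise test with `u = 1` and the
equilibrium potential. -/
theorem nullCapacity_of_boundaryTerm_eq_zero {G : WeightedGraph V} (hG : G.Connected)
    {m : V → ℝ} (hm : ∀ x, 0 < m x)
    (h : ∀ u ∈ G.DInfty, ∀ v ∈ G.DOne m, G.boundaryTerm m u v = 0) (o : V) :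
    G.NullCapacity o := by
  by_contra ho
  obtain ⟨v, hv, hvo, hvx⟩ := exists_laplacian_eq_single hG ho hm
  have h1 : (fun _ => 1 : V → ℝ) ∈ G.DInfty :=
    ⟨by simp [FiniteEnergy, summable_zero], 1, by simp⟩
  have h2 : v ∈ G.DOne m := ⟨hv, summable_of_ne_finset_zero (s := {o}) fun x hx => by
    rw [hvx x (by simpa using hx), abs_zero, zero_mul]⟩
  have h3 := h _ h1 _ h2
  have h4 : G.form (fun _ => 1) v = 0 := by simp [form]
  have h5 : pairing m (fun _ => 1) (G.laplacian m v) = G.laplacian m v o * m o := by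
    rw [pairing, tsum_eq_single o]
    · rw [one_mul]
    · intro x hx
      rw [hvx x hx, mul_zero, zero_mul]
  rw [boundaryTerm, h4, h5, zero_sub, neg_eq_zero] at h3
  exact mul_ne_zero hvo (hm o).ne' h3

end WeightedGraph

/-! ### Integrals of the heat kernel -/

theorem setLIntegral_Ioi_le_of_intervalIntegral_le {g : ℝ → ℝ} (hg : Continuous g)
    (h0 : ∀ t, 0 ≤ t → 0 ≤ g t) {C : ℝ} (hC : ∀ s, 0 < s → ∫ t in 0..s, g t ≤ C) :
    ∫⁻ t in Set.Ioi (0 : ℝ), ENNReal.ofReal (g t) ≤ ENNReal.ofReal C := by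
  have hU : Set.Ioi (0 : ℝ) = ⋃ n : ℕ, Set.Ioc (0 : ℝ) (n + 1) := by
    ext t
    simp only [Set.mem_Ioi, Set.mem_iUnion, Set.mem_Ioc]
    refine ⟨fun ht => ?_, fun ⟨_, h⟩ => h.1⟩
    obtain ⟨n, hn⟩ := exists_nat_ge t
    exact ⟨n, ht, by linarith⟩
  have hmono : Monotone fun n : ℕ => Set.Ioc (0 : ℝ) (n + 1) := fun a b hab =>
    Set.Ioc_subset_Ioc_right (by have : (a : ℝ) ≤ b := Nat.cast_le.2 hab; linarith)
  rw [hU, setLIntegral_iUnion_of_directed _ hmono.directed_le]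
  refine iSup_le fun n => ?_
  have hn : (0 : ℝ) < n + 1 := by positivity
  rw [← ofReal_integral_eq_lintegral_ofReal]
  · rw [← intervalIntegral.integral_of_le hn.le]
    exact ENNReal.ofReal_le_ofReal (hC _ hn)
  · exact (hg.integrableOn_Icc).mono_set Set.Ioc_subset_Icc_self
  · exact (ae_restrict_mem measurableSet_Ioc).mono fun t ht => h0 t ht.1.le

theorem exists_intervalIntegral_le_of_setLIntegral_ne_top {g : ℝ → ℝ} (hg : Continuous g)
    (h : ∫⁻ t in Set.Ioi (0 : ℝ), ENNReal.ofReal (g t) ≠ ⊤) :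
    ∃ C : ℝ, ∀ s, 0 < s → ∫ t in 0..s, g t ≤ C := by
  refine ⟨(∫⁻ t in Set.Ioi (0 : ℝ), ENNReal.ofReal (g t)).toReal, fun s hs => ?_⟩
  have hg' : Continuous fun t => max (g t) 0 := hg.max continuous_const
  calc ∫ t in 0..s, g t ≤ ∫ t in 0..s, max (g t) 0 :=
        intervalIntegral.integral_mono_on hs.le (hg.intervalIntegrable _ _)
          (hg'.intervalIntegrable _ _) fun t _ => le_max_left _ _
    _ = (∫⁻ t in Set.Ioc 0 s, ENNReal.ofReal (g t)).toReal := by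
        rw [intervalIntegral.integral_of_le hs.le, integral_eq_lintegral_of_nonneg_ae
          (f := fun t => max (g t) 0)
          (Eventually.of_forall fun t => le_max_right _ _) hg'.aestronglyMeasurable]
        congr 1
        refine lintegral_congr fun t => ?_
        rcases le_total (g t) 0 with h | h
        · rw [max_eq_right h, ENNReal.ofReal_zero, ENNReal.ofReal_of_nonpos h]
        · rw [max_eq_left h]
    _ ≤ _ := ENNReal.toReal_mono h (lintegral_mono_set Set.Ioc_subset_Ioi_self)

namespace WeightedGraph

section FormDomain

variable {V : Type*} {G : WeightedGraph V} {m : V → ℝ}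

theorem memFormDomain_of_finite_support {φ : V → ℝ} (h : (Function.support φ).Finite) :
    G.MemFormDomain m φ :=
  ⟨G.finiteEnergy_of_finite_support h, mem_ellTwo_of_finite_support m h, fun ε hε =>
    ⟨φ, h, by simpa [form, pairing] using hε⟩⟩

/-- Membership in the form domain means approximation by finitely supported functions both in
energy and in `ℓ²`. -/
theorem memFormDomain_iff (hm : ∀ x, 0 < m x) (u : G.energySpace) (u' : ellTwo m)
    (h : (u : V → ℝ) = u') :
    G.MemFormDomain m u ↔ ∃ (φ : ℕ → G.energySpace) (φ' : ℕ → ellTwo m),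
      (∀ n, (Function.support (φ n : V → ℝ)).Finite) ∧ (∀ n, (φ n : V → ℝ) = φ' n) ∧
      Tendsto (fun n => G.gradient (φ n)) atTop (𝓝 (G.gradient u)) ∧
      Tendsto (fun n => toL2 m hm (φ' n)) atTop (𝓝 (toL2 m hm u')) := by
  have key : ∀ (φ : G.energySpace) (φ' : ellTwo m), (φ : V → ℝ) = φ' →
      G.form ((u : V → ℝ) - φ) ((u : V → ℝ) - φ) + pairing m ((u : V → ℝ) - φ) ((u : V → ℝ) - φ) =
        ‖G.gradient u - G.gradient φ‖ ^ 2 + ‖toL2 m hm u' - toL2 m hm φ'‖ ^ 2 := by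
    intro φ φ' hφ
    rw [← map_sub, ← map_sub, ← form_self_eq_norm_sq, ← pairing_self_eq_norm_sq hm,
      Submodule.coe_sub, Submodule.coe_sub, h, hφ]
  constructor
  · rintro ⟨-, -, hu⟩
    choose φ hφ hφu using fun n : ℕ => hu (1 / ((n : ℝ) + 1)) (by positivity)
    have hlim := tendsto_one_div_add_atTop_nhds_zero_nat (𝕜 := ℝ)
    let φ₁ : ℕ → G.energySpace := fun n => ⟨φ n, G.finiteEnergy_of_finite_support (hφ n)⟩
    let φ₂ : ℕ → ellTwo m := fun n => ⟨φ n, mem_ellTwo_of_finite_support m (hφ n)⟩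
    have hb : ∀ n, √(‖G.gradient u - G.gradient (φ₁ n)‖ ^ 2 +
        ‖toL2 m hm u' - toL2 m hm (φ₂ n)‖ ^ 2) ≤ 1 / ((n : ℝ) + 1) := fun n => by
      rw [← key (φ₁ n) (φ₂ n) rfl]
      exact (hφu n).le
    refine ⟨φ₁, φ₂, hφ, fun n => rfl, ?_, ?_⟩
    · rw [tendsto_iff_norm_sub_tendsto_zero]
      refine squeeze_zero (fun n => norm_nonneg _) (fun n => le_trans ?_ (hb n)) hlim
      rw [norm_sub_rev]
      exact Real.le_sqrt_of_sq_le (le_add_of_nonneg_right (sq_nonneg _))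
    · rw [tendsto_iff_norm_sub_tendsto_zero]
      refine squeeze_zero (fun n => norm_nonneg _) (fun n => le_trans ?_ (hb n)) hlim
      rw [norm_sub_rev]
      exact Real.le_sqrt_of_sq_le (le_add_of_nonneg_left (sq_nonneg _))
  · rintro ⟨φ, φ', hφ, hφφ', h1, h2⟩
    refine ⟨u.2, h ▸ u'.2, fun ε hε => ?_⟩
    have h3 := (((tendsto_const_nhds (x := G.gradient u)).sub h1).norm.pow 2).add
      (((tendsto_const_nhds (x := toL2 m hm u')).sub h2).norm.pow 2)
    have h4 := h3.sqrt
    simp only [sub_self, norm_zero, ne_eq, OfNat.ofNat_ne_zero, not_false_eq_true, zero_pow,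
      add_zero, Real.sqrt_zero] at h4
    obtain ⟨n, hn⟩ := (h4.eventually_lt_const hε).exists
    refine ⟨φ n, hφ n, ?_⟩
    rwa [key (φ n) (φ' n) (hφφ' n)]

/-- A lower bound for the capacity of `o` extends from finitely supported functions to the form
domain. -/
theorem MemFormDomain.mul_sq_le_form (hm : ∀ x, 0 < m x) {o : V} {ε : ℝ}
    (h : ∀ φ : V → ℝ, (Function.support φ).Finite → φ o = 1 → ε ≤ G.form φ φ) {u : V → ℝ}
    (hu : G.MemFormDomain m u) : ε * u o ^ 2 ≤ G.form u u := by
  obtain ⟨φ, φ', hφ, hφφ', h1, h2⟩ :=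
    (memFormDomain_iff hm ⟨u, hu.1⟩ ⟨u, hu.2.1⟩ rfl).1 hu
  have h3 : Tendsto (fun n => (φ n : V → ℝ) o) atTop (𝓝 (u o)) := by
    have h4 := (((lp.evalCLM ℝ (fun _ : V => ℝ) 2 o).continuous.tendsto _).comp h2).div_const
      (√(m o))
    have h5 : ∀ w : ellTwo m,
        lp.evalCLM ℝ (fun _ : V => ℝ) 2 o (toL2 m hm w) / √(m o) = (w : V → ℝ) o := fun w =>
      mul_div_cancel_right₀ _ (Real.sqrt_pos.2 (hm o)).ne'
    simp only [Function.comp_apply, h5] at h4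
    simpa only [hφφ'] using h4
  have h6 := h1.norm.pow 2
  rw [← form_self_eq_norm_sq] at h6
  refine le_of_tendsto_of_tendsto' ((h3.pow 2).const_mul ε) h6 fun n => ?_
  rw [← form_self_eq_norm_sq]
  rcases eq_or_ne ((φ n : V → ℝ) o) 0 with h0 | h0
  · rw [h0, zero_pow two_ne_zero, mul_zero]
    exact G.form_self_nonneg
  · have h7 := h (((φ n : V → ℝ) o)⁻¹ • (φ n : V → ℝ))
      ((hφ n).subset (Function.support_const_smul_subset _ _)) (inv_mul_cancel₀ h0)
    have h8 := G.form_self_eq_norm_sq (((φ n : V → ℝ) o)⁻¹ • φ n)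
    rw [Submodule.coe_smul, map_smul, norm_smul, mul_pow, ← form_self_eq_norm_sq, norm_inv,
      inv_pow, Real.norm_eq_abs, sq_abs] at h8
    rw [h8, ← div_eq_inv_mul, le_div_iff₀ (by positivity)] at h7
    exact h7

end FormDomain

variable {V : Type*} {G : WeightedGraph V} {m : V → ℝ} {T : ℝ → ellTwo m →ₗ[ℝ] ellTwo m}

/-- The orbit `t ↦ T t f`, extended by `f` to `t ≤ 0`, in the Hilbert space `ℓ²(V)`. -/
noncomputable def orbit (hm : ∀ x, 0 < m x) (T : ℝ → ellTwo m →ₗ[ℝ] ellTwo m) (f : ellTwo m)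
    (t : ℝ) : lp (fun _ : V => ℝ) 2 :=
  toL2 m hm (if 0 < t then T t f else f)

/-- The integrated orbit `∫₀ˢ T t f dt`. -/
noncomputable def integratedOrbit (hm : ∀ x, 0 < m x) (T : ℝ → ellTwo m →ₗ[ℝ] ellTwo m)
    (f : ellTwo m) (s : ℝ) : ellTwo m :=
  (toL2 m hm).symm (∫ t in 0..s, orbit hm T f t)

theorem orbit_of_pos (hm : ∀ x, 0 < m x) (f : ellTwo m) {t : ℝ} (ht : 0 < t) :
    orbit hm T f t = toL2 m hm (T t f) := by
  rw [orbit, if_pos ht]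

theorem orbit_of_nonpos (hm : ∀ x, 0 < m x) (f : ellTwo m) {t : ℝ} (ht : t ≤ 0) :
    orbit hm T f t = toL2 m hm f := by
  rw [orbit, if_neg ht.not_gt]

namespace IsAssociatedSemigroup

theorem norm_le (hT : G.IsAssociatedSemigroup m T) (hm : ∀ x, 0 < m x) {t : ℝ} (ht : 0 < t)
    (f : ellTwo m) : ‖toL2 m hm (T t f)‖ ≤ ‖toL2 m hm f‖ := by
  have h := hT.contractive t ht f
  rw [pairing_self_eq_norm_sq hm, pairing_self_eq_norm_sq hm] at h
  exact abs_le_of_sq_le_sq' h (norm_nonneg _) |>.2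

/-- The contraction `T t` on the Hilbert space `ℓ²(V)`. -/
noncomputable def toCLM (hT : G.IsAssociatedSemigroup m T) (hm : ∀ x, 0 < m x) {t : ℝ}
    (ht : 0 < t) : lp (fun _ : V => ℝ) 2 →L[ℝ] lp (fun _ : V => ℝ) 2 :=
  ((toL2 m hm).toLinearMap ∘ₗ T t ∘ₗ (toL2 m hm).symm.toLinearMap).mkContinuous 1 fun f => by
    simpa using hT.norm_le hm ht ((toL2 m hm).symm f)

theorem toCLM_orbit (hT : G.IsAssociatedSemigroup m T) (hm : ∀ x, 0 < m x) {t : ℝ}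
    (ht : 0 < t) (f : ellTwo m) {s : ℝ} (hs : 0 ≤ s) :
    hT.toCLM hm ht (orbit hm T f s) = orbit hm T f (t + s) := by
  rw [orbit_of_pos hm f (by linarith : 0 < t + s)]
  rcases hs.eq_or_lt with rfl | hs
  · simp [orbit_of_nonpos hm f le_rfl, toCLM]
  · simp [orbit_of_pos hm f hs, toCLM, hT.semigroup t s ht hs]

theorem continuous_orbit (hT : G.IsAssociatedSemigroup m T) (hm : ∀ x, 0 < m x) (f : ellTwo m) :
    Continuous (orbit hm T f) := by
  have h0 : ∀ ε > 0, ∃ δ > 0, ∀ h, 0 < h → h < δ → ‖toL2 m hm (T h f) - toL2 m hm f‖ < ε := by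
    intro ε hε
    have h := (hT.strongly_continuous f).sqrt
    simp only [pairing_self_eq_norm_sq hm, Real.sqrt_sq (norm_nonneg _), Real.sqrt_zero] at h
    have h' := h.eventually_lt_const hε
    rw [eventually_nhdsWithin_iff, Metric.eventually_nhds_iff] at h'
    obtain ⟨δ, hδ, h'⟩ := h'
    refine ⟨δ, hδ, fun h h1 h2 => ?_⟩
    rw [← map_sub]
    exact h' (by rwa [Real.dist_0_eq_abs, abs_of_pos h1]) h1
  -- contractivity transports continuity at `0` to a uniform modulus: for `0 < a < b`,
  -- `T b f - T a f = T a (T (b - a) f - f)`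
  have key : ∀ ε > 0, ∃ δ > 0, ∀ a b, a < b → b < a + δ →
      dist (orbit hm T f a) (orbit hm T f b) < ε := by
    intro ε hε
    obtain ⟨δ, hδ, h⟩ := h0 ε hε
    refine ⟨δ, hδ, fun a b hab hb => ?_⟩
    rw [dist_comm, dist_eq_norm]
    rcases le_or_gt b 0 with hb0 | hb0
    · rwa [orbit_of_nonpos hm f hb0, orbit_of_nonpos hm f (hab.le.trans hb0), sub_self, norm_zero]
    rw [orbit_of_pos hm f hb0]
    rcases le_or_gt a 0 with ha | ha
    · rw [orbit_of_nonpos hm f ha]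
      exact h b hb0 (by linarith)
    · have h1 : T b f = T a (T (b - a) f) := by
        rw [← LinearMap.comp_apply, ← hT.semigroup a (b - a) ha (by linarith),
          add_sub_cancel]
      rw [orbit_of_pos hm f ha, h1, ← map_sub, ← map_sub]
      refine (hT.norm_le hm ha _).trans_lt ?_
      rw [map_sub]
      exact h _ (by linarith) (by linarith)
  refine (Metric.uniformContinuous_iff.2 fun ε hε => ?_).continuous
  obtain ⟨δ, hδ, h⟩ := key ε hε
  refine ⟨δ, hδ, fun {a b} hab => ?_⟩
  rw [Real.dist_eq, abs_lt] at hab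
  rcases lt_trichotomy a b with h1 | rfl | h1
  · exact h a b h1 (by linarith)
  · rwa [dist_self]
  · rw [dist_comm]
    exact h b a h1 (by linarith)

/-- `L ∫₀ˢ T t f dt = f - T s f`. -/
theorem isOperatorValue_integratedOrbit (hT : G.IsAssociatedSemigroup m T)
    (hm : ∀ x, 0 < m x) (f : ellTwo m) {s : ℝ} (hs : 0 < s) :
    G.IsOperatorValue m (integratedOrbit hm T f s) (f - T s f) := by
  have hc := hT.continuous_orbit hm f
  set F : ℝ → lp (fun _ : V => ℝ) 2 := fun s => ∫ t in 0..s, orbit hm T f t with hF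
  have hderiv : ∀ t, HasDerivAt F (orbit hm T f t) t := fun t =>
    intervalIntegral.integral_hasDerivAt_right (hc.intervalIntegrable _ _)
      (hc.stronglyMeasurableAtFilter _ _) hc.continuousAt
  have hshift : ∀ h, 0 < h → toL2 m hm (T h (integratedOrbit hm T f s)) = F (s + h) - F h := by
    intro h hh
    change hT.toCLM hm hh (F s) = _
    rw [hF, ← ContinuousLinearMap.intervalIntegral_comp_comm _ (hc.intervalIntegrable _ _),
      intervalIntegral.integral_interval_sub_left (hc.intervalIntegrable _ _)
        (hc.intervalIntegrable _ _)]
    have h1 := intervalIntegral.integral_comp_add_right (a := 0) (b := s) (orbit hm T f) h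
    rw [zero_add] at h1
    rw [← h1]
    refine intervalIntegral.integral_congr fun t ht => ?_
    rw [Set.uIcc_of_le hs.le] at ht
    rw [add_comm t h]
    exact hT.toCLM_orbit hm hh f ht.1
  -- `u - T h u = (F h - F 0) - (F (s + h) - F s)`, whose quotient by `h` tends to `f - T s f`
  rw [← hT.generator]
  have h1 := (hasDerivAt_iff_tendsto_slope_zero.1 (hderiv 0)).sub
    (hasDerivAt_iff_tendsto_slope_zero.1 (hderiv s))
  have h2 := (h1.mono_left (nhdsWithin_mono 0 fun t (ht : 0 < t) => ht.ne')).sub_const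
    (orbit hm T f 0 - orbit hm T f s)
  rw [sub_self] at h2
  have h3 := h2.norm.pow 2
  rw [norm_zero, zero_pow two_ne_zero] at h3
  refine h3.congr' (eventually_nhdsWithin_of_forall fun h (hh : 0 < h) => ?_)
  beta_reduce
  rw [pairing_self_eq_norm_sq hm, map_sub, map_smul, map_sub, map_sub, hshift h hh,
    orbit_of_nonpos hm f le_rfl, orbit_of_pos hm f hs]
  have h4 : toL2 m hm (integratedOrbit hm T f s) = F s := LinearEquiv.apply_symm_apply _ _
  have h5 : F 0 = 0 := intervalIntegral.integral_same
  rw [h4, ← smul_sub, zero_add, h5]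
  congr 4
  abel

theorem integratedOrbit_apply (hT : G.IsAssociatedSemigroup m T) (hm : ∀ x, 0 < m x)
    (f : ellTwo m) (s : ℝ) (y : V) :
    (integratedOrbit hm T f s : V → ℝ) y =
      ∫ t in 0..s, ((toL2 m hm).symm (orbit hm T f t) : V → ℝ) y := by
  have hc := hT.continuous_orbit hm f
  have h := (lp.evalCLM ℝ (fun _ : V => ℝ) 2 y).intervalIntegral_comp_comm
    (hc.intervalIntegrable (μ := volume) 0 s)
  simp only [toL2_symm_apply, intervalIntegral.integral_div]
  rw [integratedOrbit, toL2_symm_apply]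
  congr 1
  exact h.symm

theorem continuous_orbit_apply (hT : G.IsAssociatedSemigroup m T) (hm : ∀ x, 0 < m x)
    (f : ellTwo m) (y : V) :
    Continuous fun t => ((toL2 m hm).symm (orbit hm T f t) : V → ℝ) y := by
  simp only [toL2_symm_apply]
  exact ((lp.evalCLM ℝ (fun _ : V => ℝ) 2 y).continuous.comp (hT.continuous_orbit hm f)).div_const _

/-- By symmetry, `⟨f, T t f⟩ = ⟨T (t / 2) f, T (t / 2) f⟩`. -/
theorem inner_eq_norm_sq (hT : G.IsAssociatedSemigroup m T) (hm : ∀ x, 0 < m x) (f : ellTwo m)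
    {t : ℝ} (ht : 0 ≤ t) :
    inner ℝ (toL2 m hm f) (orbit hm T f t) = ‖orbit hm T f (t / 2)‖ ^ 2 := by
  rcases ht.eq_or_lt with rfl | ht
  · rw [zero_div, orbit_of_nonpos hm f le_rfl, real_inner_self_eq_norm_sq]
  · have ht2 : 0 < t / 2 := by linarith
    have h1 : T t f = T (t / 2) (T (t / 2) f) := by
      rw [← LinearMap.comp_apply, ← hT.semigroup _ _ ht2 ht2, add_halves]
    rw [orbit_of_pos hm f ht, orbit_of_pos hm f ht2, ← real_inner_self_eq_norm_sq,
      ← pairing_eq_inner hm, ← pairing_eq_inner hm, h1, hT.symmetric _ ht2]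

/-- `‖T t f‖` is nonincreasing in `t`. -/
theorem norm_orbit_anti (hT : G.IsAssociatedSemigroup m T) (hm : ∀ x, 0 < m x) (f : ellTwo m)
    {s t : ℝ} (hs : 0 ≤ s) (hst : s ≤ t) : ‖orbit hm T f t‖ ≤ ‖orbit hm T f s‖ := by
  rcases hst.eq_or_lt with rfl | hst
  · rfl
  · have h := hT.toCLM_orbit hm (sub_pos.2 hst) f hs
    rw [sub_add_cancel] at h
    rw [← h]
    have := (hT.toCLM hm (sub_pos.2 hst)).le_of_opNorm_le
      (LinearMap.mkContinuous_norm_le _ zero_le_one _) (orbit hm T f s)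
    rwa [one_mul] at this

/-- The diagonal of the heat kernel is the square of a norm. -/
theorem diagonal_eq (hT : G.IsAssociatedSemigroup m T) (hm : ∀ x, 0 < m x) (o : V)
    {t : ℝ} (ht : 0 ≤ t) :
    ((toL2 m hm).symm (orbit hm T (deltaFun m o) t) : V → ℝ) o * m o =
      ‖orbit hm T (deltaFun m o) (t / 2)‖ ^ 2 := by
  rw [← hT.inner_eq_norm_sq hm _ ht, ← inner_toL2_deltaFun hm, LinearEquiv.apply_symm_apply]

theorem diagonal_nonneg (hT : G.IsAssociatedSemigroup m T) (hm : ∀ x, 0 < m x) (o : V)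
    {t : ℝ} (ht : 0 ≤ t) :
    0 ≤ ((toL2 m hm).symm (orbit hm T (deltaFun m o) t) : V → ℝ) o :=
  nonneg_of_mul_nonneg_left (by rw [hT.diagonal_eq hm o ht]; positivity) (hm o)

theorem inner_orbit_nonneg (hT : G.IsAssociatedSemigroup m T) (hm : ∀ x, 0 < m x) (f : ellTwo m)
    {s t : ℝ} (hs : 0 < s) (ht : 0 ≤ t) :
    0 ≤ inner ℝ (orbit hm T f s) (orbit hm T f t) := by
  have h : inner ℝ (orbit hm T f s) (orbit hm T f t) =
      inner ℝ (toL2 m hm f) (orbit hm T f (s + t)) := by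
    rw [← hT.toCLM_orbit hm hs f ht, orbit_of_pos hm f hs]
    have := hT.symmetric s hs f ((toL2 m hm).symm (orbit hm T f t))
    rwa [pairing_eq_inner hm, pairing_eq_inner hm, LinearEquiv.apply_symm_apply] at this
  rw [h, hT.inner_eq_norm_sq hm f (by linarith)]
  positivity

/-- The energy of `∫₀ˢ T t δ_o dt` is `⟨δ_o - T s δ_o, ∫₀ˢ T t δ_o dt⟩`, and the contribution
of `T s δ_o` has a sign. -/
theorem form_integratedOrbit_le (hT : G.IsAssociatedSemigroup m T) (hm : ∀ x, 0 < m x) (o : V)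
    {s : ℝ} (hs : 0 < s) :
    G.form (integratedOrbit hm T (deltaFun m o) s) (integratedOrbit hm T (deltaFun m o) s) ≤
      m o * (integratedOrbit hm T (deltaFun m o) s : V → ℝ) o := by
  set f := deltaFun m o
  obtain ⟨h1, h2⟩ := hT.isOperatorValue_integratedOrbit hm f hs
  have h3 : 0 ≤ inner ℝ (orbit hm T f s) (∫ t in 0..s, orbit hm T f t) := by
    have h4 := (innerSL ℝ (orbit hm T f s)).intervalIntegral_comp_comm
      ((hT.continuous_orbit hm f).intervalIntegrable (μ := volume) 0 s)
    simp only [innerSL_apply_apply] at h4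
    rw [← h4]
    exact intervalIntegral.integral_nonneg hs.le fun t ht => hT.inner_orbit_nonneg hm f hs ht.1
  rw [h2 _ h1, pairing_eq_inner hm, map_sub, inner_sub_left, inner_toL2_deltaFun hm,
    mul_comm (m o), ← orbit_of_pos hm f hs]
  have h5 : toL2 m hm (integratedOrbit hm T f s) = ∫ t in 0..s, orbit hm T f t :=
    LinearEquiv.apply_symm_apply _ _
  rw [h5]
  linarith

/-- Only positive times enter the integral, so the semigroup may be replaced by the extended
orbit, which is continuous on the whole line. -/
theorem setLIntegral_eq (hm : ∀ x, 0 < m x) (T : ℝ → ellTwo m →ₗ[ℝ] ellTwo m) (f : ellTwo m)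
    (y : V) :
    ∫⁻ t in Set.Ioi (0 : ℝ), ENNReal.ofReal ((T t f : V → ℝ) y) =
      ∫⁻ t in Set.Ioi (0 : ℝ), ENNReal.ofReal (((toL2 m hm).symm (orbit hm T f t) : V → ℝ) y) := by
  refine setLIntegral_congr_fun measurableSet_Ioi fun t ht => ?_
  simp only [orbit_of_pos hm f ht, LinearEquiv.symm_apply_apply]

/-- If the diagonal heat kernel has infinite time integral, then `o` has capacity zero: the
functions `u s = ∫₀ˢ T t δ_o dt` satisfy `Q(u s) ≤ m o * u s o`, so that a lower bound
`ε * u s o ^ 2 ≤ Q(u s)` would bound `u s o`. -/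
theorem nullCapacity (hT : G.IsAssociatedSemigroup m T) (hm : ∀ x, 0 < m x) (o : V)
    (ho : ∫⁻ t in Set.Ioi (0 : ℝ), ENNReal.ofReal ((T t (deltaFun m o) : V → ℝ) o) = ⊤) :
    G.NullCapacity o := by
  by_contra hcap
  simp only [NullCapacity, not_forall, not_exists, not_and, not_lt] at hcap
  obtain ⟨ε, hε, hcap⟩ := hcap
  rw [setLIntegral_eq hm] at ho
  refine ENNReal.ofReal_ne_top (r := m o / ε) (top_le_iff.1 (ho.symm.le.trans ?_))
  refine setLIntegral_Ioi_le_of_intervalIntegral_le (hT.continuous_orbit_apply hm _ o)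
    (fun t ht => hT.diagonal_nonneg hm o ht) fun s hs => ?_
  rw [← hT.integratedOrbit_apply hm]
  have h1 := (hT.isOperatorValue_integratedOrbit hm (deltaFun m o) hs).1.mul_sq_le_form hm hcap
  have h2 := h1.trans (hT.form_integratedOrbit_le hm o hs)
  by_contra! h3
  rw [div_lt_iff₀ hε] at h3
  have h4 : 0 < (integratedOrbit hm T (deltaFun m o) s : V → ℝ) o := by
    by_contra! h5
    nlinarith [hm o]
  nlinarith

/-- If the integrated diagonal heat kernel is bounded, then `T s δ_o → 0` since
`‖T s δ_o‖ ^ 2` is a decreasing multiple of the diagonal at time `2 s`. -/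
theorem tendsto_norm_orbit (hT : G.IsAssociatedSemigroup m T) (hm : ∀ x, 0 < m x) {o : V}
    {C : ℝ} (hC : ∀ s, 0 < s → (integratedOrbit hm T (deltaFun m o) s : V → ℝ) o ≤ C) :
    Tendsto (fun s => ‖orbit hm T (deltaFun m o) s‖) atTop (𝓝 0) := by
  set f := deltaFun m o
  have h1 : ∀ s, 0 < s → ‖orbit hm T f s‖ ^ 2 ≤ m o * C / 2 * s⁻¹ := by
    intro s hs
    have h2 := hC (2 * s) (by linarith)
    have hcont := hT.continuous_orbit_apply hm f o
    rw [hT.integratedOrbit_apply hm] at h2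
    have h3 : ∫ _ in 0..2 * s, ‖orbit hm T f s‖ ^ 2 / m o ≤
        ∫ t in 0..2 * s, ((toL2 m hm).symm (orbit hm T f t) : V → ℝ) o := by
      refine intervalIntegral.integral_mono_on (by linarith)
        (continuous_const.intervalIntegrable _ _) (hcont.intervalIntegrable _ _) fun t ht => ?_
      rw [div_le_iff₀ (hm o), hT.diagonal_eq hm o ht.1]
      exact pow_le_pow_left₀ (norm_nonneg _)
        (hT.norm_orbit_anti hm f (by linarith [ht.1]) (by linarith [ht.2])) 2
    rw [intervalIntegral.integral_const, sub_zero, smul_eq_mul] at h3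
    have h4 := h3.trans h2
    rw [← mul_div_assoc, div_le_iff₀ (hm o)] at h4
    rw [← div_eq_mul_inv, le_div_iff₀ hs]
    linarith
  have h5 : Tendsto (fun s : ℝ => m o * C / 2 * s⁻¹) atTop (𝓝 0) := by
    simpa using tendsto_inv_atTop_zero.const_mul (m o * C / 2)
  have h6 := (squeeze_zero' (Eventually.of_forall fun s => sq_nonneg _)
    ((eventually_gt_atTop 0).mono h1) h5).sqrt
  simpa only [Real.sqrt_sq (norm_nonneg _), Real.sqrt_zero] using h6

/-- If `o` has capacity zero, then the integrated diagonal heat kernel is unbounded. Otherwise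
`T s δ_o → 0`, and testing `L u s = δ_o - T s δ_o` with a function `φ` of small energy with
`φ o = 1` gives a contradiction. -/
theorem exists_lt_integratedOrbit (hT : G.IsAssociatedSemigroup m T) (hm : ∀ x, 0 < m x) {o : V}
    (ho : G.NullCapacity o) (C : ℝ) :
    ∃ s, 0 < s ∧ C < (integratedOrbit hm T (deltaFun m o) s : V → ℝ) o := by
  by_contra! hC'
  obtain ⟨D, hD, hC⟩ : ∃ D, 0 < D ∧
      ∀ s, 0 < s → (integratedOrbit hm T (deltaFun m o) s : V → ℝ) o ≤ D :=
    ⟨max C 1, by positivity, fun s hs => (hC' s hs).trans (le_max_left _ _)⟩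
  have hmo := hm o
  -- chosen so that `Q(u s) * Q(φ) ≤ (m o * D) * (m o / (4 * D)) = (m o / 2) ^ 2`
  obtain ⟨φ, hφ, hφo, hφε⟩ := ho (m o / (4 * D)) (by positivity)
  have hφdom : G.MemFormDomain m φ := memFormDomain_of_finite_support hφ
  let φ' : ellTwo m := ⟨φ, hφdom.2.1⟩
  have hsmall : ∀ᶠ s in atTop,
      ‖orbit hm T (deltaFun m o) s‖ * ‖toL2 m hm φ'‖ < m o / 2 := by
    have h := (hT.tendsto_norm_orbit hm hC).mul_const ‖toL2 m hm φ'‖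
    rw [zero_mul] at h
    exact h.eventually_lt_const (by positivity)
  obtain ⟨s, hs1, hs⟩ := (hsmall.and (eventually_gt_atTop 0)).exists
  obtain ⟨hdom, hval⟩ := hT.isOperatorValue_integratedOrbit hm (deltaFun m o) hs
  have h1 := hval φ hφdom
  have h2 : pairing m (deltaFun m o - T s (deltaFun m o) : ellTwo m) φ =
      m o - inner ℝ (orbit hm T (deltaFun m o) s) (toL2 m hm φ') := by
    have h3 := pairing_eq_inner hm (deltaFun m o - T s (deltaFun m o)) φ'
    rw [map_sub, inner_sub_left, inner_toL2_deltaFun, ← orbit_of_pos hm _ hs] at h3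
    rw [h3]
    simp [φ', hφo]
  have h4 := (abs_real_inner_le_norm (orbit hm T (deltaFun m o) s) (toL2 m hm φ')).trans_lt hs1
  have h5 : |G.form (integratedOrbit hm T (deltaFun m o) s) φ| ≤ m o / 2 := by
    have h6 := G.form_eq_inner ⟨_, hdom.1⟩ ⟨φ, hφdom.1⟩
    have h7 := abs_real_inner_le_norm (G.gradient ⟨_, hdom.1⟩) (G.gradient ⟨φ, hφdom.1⟩)
    rw [← h6] at h7
    refine h7.trans (abs_le_of_sq_le_sq' ?_ (by positivity)).2
    rw [mul_pow, ← form_self_eq_norm_sq, ← form_self_eq_norm_sq]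
    have h8 := (hT.form_integratedOrbit_le hm o hs).trans
      (mul_le_mul_of_nonneg_left (hC s hs) hmo.le)
    calc _ ≤ m o * D * (m o / (4 * D)) :=
          mul_le_mul h8 hφε.le G.form_self_nonneg (by positivity)
      _ = (m o / 2) ^ 2 := by
          field_simp
          ring
  rw [h2] at h1
  have h9 := (abs_lt.1 h4).2
  have h10 := (abs_le.1 h5).2
  linarith

/-- In a connected graph `(u s o - u s y) ^ 2 ≤ C * Q(u s) ≤ C * m o * u s o`, so that the
integrated heat kernel is unbounded off the diagonal as soon as it is on the diagonal. -/
theorem setLIntegral_eq_top (hT : G.IsAssociatedSemigroup m T) (hG : G.Connected)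
    (hm : ∀ x, 0 < m x) {o : V} (ho : G.NullCapacity o) (y : V) :
    ∫⁻ t in Set.Ioi (0 : ℝ), ENNReal.ofReal ((T t (deltaFun m o) : V → ℝ) y) = ⊤ := by
  rw [setLIntegral_eq hm]
  by_contra hne
  obtain ⟨B, hB⟩ := exists_intervalIntegral_le_of_setLIntegral_ne_top
    (hT.continuous_orbit_apply hm _ y) hne
  obtain ⟨C, hC0, hC⟩ := hG.exists_sq_sub_le o y
  have hmo := hm o
  -- with `a = u s o` and `c = u s y ≤ max B 0 ≤ a / 2`, the bound `(a - c) ^ 2 ≤ C * m o * a`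
  -- fails as soon as `a > 4 * C * m o`
  obtain ⟨s, hs, hlt⟩ := hT.exists_lt_integratedOrbit hm ho (2 * max B 0 + 4 * (C * m o))
  have h1 := hB s hs
  rw [← hT.integratedOrbit_apply hm] at h1
  have h2 := hC _ (hT.isOperatorValue_integratedOrbit hm (deltaFun m o) hs).1.1
  have h3 := mul_le_mul_of_nonneg_left (hT.form_integratedOrbit_le hm o hs) hC0
  have h4 : 0 ≤ C * m o := by positivity
  have h5 := le_max_right B 0
  have h6 := le_max_left B 0
  set a := (integratedOrbit hm T (deltaFun m o) s : V → ℝ) o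
  set c := (integratedOrbit hm T (deltaFun m o) s : V → ℝ) y
  have h7 : a / 2 ≤ a - c := by linarith
  have h8 : 0 < a := by linarith
  nlinarith [mul_le_mul h7 h7 (by positivity) (by linarith)]

end IsAssociatedSemigroup

end WeightedGraph

/-! ### Semigroups from the functional calculus of the resolvent -/

/-- The function `s ↦ exp (-t (1 / s - 1))` on `(0, 1]`, extended by `0` to `s ≤ 0`. If
`A = (1 + L)⁻¹`, then applying it to `A` gives `e^{-tL}`; it is continuous although `L` is
unbounded. -/
noncomputable def heatSymbol (t s : ℝ) : ℝ := Real.exp t * expNegInvGlue (s / t)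

theorem continuous_heatSymbol (t : ℝ) : Continuous (heatSymbol t) :=
  continuous_const.mul ((expNegInvGlue.contDiff (n := 0)).continuous.comp
    (continuous_id.div_const t))

theorem heatSymbol_zero (t : ℝ) : heatSymbol t 0 = 0 := by
  simp [heatSymbol, expNegInvGlue]

theorem heatSymbol_of_pos {t s : ℝ} (ht : 0 < t) (hs : 0 < s) :
    heatSymbol t s = Real.exp (-(t * (1 / s - 1))) := by
  rw [heatSymbol, expNegInvGlue, if_neg (div_pos hs ht).not_ge, ← Real.exp_add]
  congr 1
  field_simp
  ring

theorem heatSymbol_add {t t' s : ℝ} (ht : 0 < t) (ht' : 0 < t') (hs : 0 ≤ s) :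
    heatSymbol (t + t') s = heatSymbol t s * heatSymbol t' s := by
  rcases hs.eq_or_lt with rfl | hs
  · simp [heatSymbol_zero]
  · rw [heatSymbol_of_pos (add_pos ht ht') hs, heatSymbol_of_pos ht hs, heatSymbol_of_pos ht' hs,
      ← Real.exp_add]
    congr 1
    ring

theorem heatSymbol_nonneg (t s : ℝ) : 0 ≤ heatSymbol t s :=
  mul_nonneg (Real.exp_pos t).le (expNegInvGlue.nonneg _)

theorem heatSymbol_le_one {t s : ℝ} (ht : 0 < t) (hs : 0 ≤ s) (hs1 : s ≤ 1) :
    heatSymbol t s ≤ 1 := by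
  rcases hs.eq_or_lt with rfl | hs
  · simp [heatSymbol_zero]
  · rw [heatSymbol_of_pos ht hs, Real.exp_le_one_iff, neg_nonpos]
    have : 1 ≤ 1 / s := by rwa [le_div_iff₀ hs, one_mul]
    exact mul_nonneg ht.le (by linarith)

/-- The difference quotient at `t = 0`, multiplied by `s` so as to be bounded, is at most
`1 - s`. -/
theorem mul_one_sub_heatSymbol_le {t s : ℝ} (ht : 0 < t) (hs : 0 ≤ s) :
    s * (1 - heatSymbol t s) ≤ t * (1 - s) := by
  rcases hs.eq_or_lt with rfl | hs
  · simpa using ht.le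
  · rw [heatSymbol_of_pos ht hs]
    have h := Real.add_one_le_exp (-(t * (1 / s - 1)))
    have h1 : s * (t * (1 / s - 1)) = t * (1 - s) := by field_simp
    nlinarith [mul_le_mul_of_nonneg_left h hs.le]

/-- A second order bound, from `exp (-y) ≤ 1 / (1 + y) ≤ 1 - y + y ^ 2`. -/
theorem mul_sub_heatSymbol_le {t s : ℝ} (ht : 0 < t) (hs : 0 ≤ s) (hs1 : s ≤ 1) :
    s * (t * (1 - s) - s * (1 - heatSymbol t s)) ≤ t ^ 2 := by
  rcases hs.eq_or_lt with rfl | hs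
  · simpa using sq_nonneg t
  · rw [heatSymbol_of_pos ht hs]
    set y := t * (1 / s - 1) with hy
    have h1 : s * y = t * (1 - s) := by rw [hy]; field_simp
    have hy0 : 0 ≤ y := nonneg_of_mul_nonneg_right (by rw [h1]; nlinarith) hs
    have h2 : Real.exp (-y) ≤ 1 - y + y ^ 2 := by
      rw [Real.exp_neg]
      refine (inv_anti₀ (by linarith) (Real.add_one_le_exp y)).trans ?_
      rw [inv_le_iff_one_le_mul₀ (by linarith)]
      nlinarith [pow_nonneg hy0 3]
    have h3 := mul_le_mul_of_nonneg_left h2 (sq_nonneg s)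
    have h4 : (s * y) ^ 2 ≤ t ^ 2 := by
      rw [h1]
      exact pow_le_pow_left₀ (by nlinarith) (by nlinarith) 2
    have h5 : s * (s * y) = s * (t * (1 - s)) := by rw [h1]
    nlinarith

section CStarAlgebra

variable {𝒜 : Type*} [CStarAlgebra 𝒜] {a : 𝒜}

theorem cfc_heatSymbol_add (ha : ∀ s ∈ spectrum ℝ a, 0 ≤ s ∧ s ≤ 1) {t t' : ℝ}
    (ht : 0 < t) (ht' : 0 < t') :
    cfc (heatSymbol (t + t')) a = cfc (heatSymbol t) a * cfc (heatSymbol t') a := by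
  rw [← cfc_mul (heatSymbol t) (heatSymbol t') a (continuous_heatSymbol t).continuousOn
    (continuous_heatSymbol t').continuousOn]
  exact cfc_congr fun s hs => heatSymbol_add ht ht' (ha s hs).1

theorem norm_cfc_heatSymbol_le (ha : ∀ s ∈ spectrum ℝ a, 0 ≤ s ∧ s ≤ 1) {t : ℝ} (ht : 0 < t) :
    ‖cfc (heatSymbol t) a‖ ≤ 1 := by
  refine norm_cfc_le zero_le_one fun s hs => ?_
  rw [Real.norm_of_nonneg (heatSymbol_nonneg t s)]
  exact heatSymbol_le_one ht (ha s hs).1 (ha s hs).2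

theorem norm_sub_cfc_heatSymbol_mul_le (hsa : IsSelfAdjoint a)
    (ha : ∀ s ∈ spectrum ℝ a, 0 ≤ s ∧ s ≤ 1) {t : ℝ} (ht : 0 < t) :
    ‖a - cfc (heatSymbol t) a * a‖ ≤ t := by
  have hc := continuous_heatSymbol t
  have h : a - cfc (heatSymbol t) a * a = cfc (fun s => s - heatSymbol t s * s) a := by
    rw [cfc_sub (fun s => s) (fun s => heatSymbol t s * s) a, cfc_mul (heatSymbol t) (fun s => s) a,
      cfc_id' ℝ a]
  rw [h]
  refine norm_cfc_le ht.le fun s hs => ?_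
  obtain ⟨h0, h1⟩ := ha s hs
  have h2 := heatSymbol_le_one ht h0 h1
  have h3 := mul_one_sub_heatSymbol_le ht h0
  rw [Real.norm_eq_abs, abs_le]
  constructor <;> nlinarith

theorem norm_sub_cfc_heatSymbol_mul_sub_mul_le (hsa : IsSelfAdjoint a)
    (ha : ∀ s ∈ spectrum ℝ a, 0 ≤ s ∧ s ≤ 1) {t : ℝ} (ht : 0 < t) :
    ‖(a - cfc (heatSymbol t) a * a - t • (1 - a)) * a‖ ≤ t ^ 2 := by
  have hc := continuous_heatSymbol t
  have h : (a - cfc (heatSymbol t) a * a - t • (1 - a)) * a =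
      cfc (fun s => (s - heatSymbol t s * s - t * (1 - s)) * s) a := by
    rw [cfc_mul (fun s => s - heatSymbol t s * s - t * (1 - s)) (fun s => s) a,
      cfc_sub (fun s => s - heatSymbol t s * s) (fun s => t * (1 - s)) a,
      cfc_sub (fun s => s) (fun s => heatSymbol t s * s) a,
      cfc_mul (heatSymbol t) (fun s => s) a,
      cfc_const_mul t (fun s => 1 - s) a, cfc_sub (fun _ => 1) (fun s => s) a,
      cfc_const_one ℝ a, cfc_id' ℝ a]
  rw [h]
  refine norm_cfc_le (by positivity) fun s hs => ?_
  obtain ⟨h0, h1⟩ := ha s hs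
  have h2 := mul_one_sub_heatSymbol_le ht h0
  have h3 := mul_sub_heatSymbol_le ht h0 h1
  rw [Real.norm_eq_abs, abs_le]
  constructor <;> nlinarith [sq_nonneg t]

end CStarAlgebra

section Complexification

variable (H E : Type*) [NormedAddCommGroup H] [InnerProductSpace ℝ H]
  [NormedAddCommGroup E] [InnerProductSpace ℂ E]

/-- An identification of the complex Hilbert space `E` with the complexification of the real Hilbert
space `H`: every `z` is `ofReal (re z) + i ofReal (im z)`, and `ofReal` preserves inner products. -/
structure RealStructure where
  ofReal : H →+ E
  re : E →+ H
  im : E →+ H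
  re_ofReal : ∀ f, re (ofReal f) = f
  im_ofReal : ∀ f, im (ofReal f) = 0
  ofReal_re_add_im : ∀ z, ofReal (re z) + Complex.I • ofReal (im z) = z
  re_smul : ∀ (c : ℂ) z, re (c • z) = c.re • re z - c.im • im z
  im_smul : ∀ (c : ℂ) z, im (c • z) = c.re • im z + c.im • re z
  inner_ofReal : ∀ f g, inner ℂ (ofReal f) (ofReal g) = (inner ℝ f g : ℂ)

variable {H E}

namespace RealStructure

variable (R : RealStructure H E)

theorem ext {z w : E} (h : R.re z = R.re w) (h' : R.im z = R.im w) : z = w := by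
  rw [← R.ofReal_re_add_im z, ← R.ofReal_re_add_im w, h, h']

theorem re_mk (f g : H) : R.re (R.ofReal f + Complex.I • R.ofReal g) = f := by
  simp [R.re_smul, R.re_ofReal, R.im_ofReal]

theorem im_mk (f g : H) : R.im (R.ofReal f + Complex.I • R.ofReal g) = g := by
  simp [R.im_smul, R.re_ofReal, R.im_ofReal]

theorem ofReal_smul (r : ℝ) (f : H) : R.ofReal (r • f) = (r : ℂ) • R.ofReal f :=
  R.ext (by rw [R.re_smul, R.re_ofReal, R.re_ofReal, R.im_ofReal, smul_zero, sub_zero,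
      Complex.ofReal_re])
    (by rw [R.im_smul, R.re_ofReal, R.im_ofReal, R.im_ofReal, smul_zero, zero_add,
      Complex.ofReal_im, zero_smul])

theorem inner_eq (z w : E) :
    inner ℂ z w = ((inner ℝ (R.re z) (R.re w) + inner ℝ (R.im z) (R.im w) : ℝ) : ℂ) +
      ((inner ℝ (R.re z) (R.im w) - inner ℝ (R.im z) (R.re w) : ℝ) : ℂ) * Complex.I := by
  conv_lhs => rw [← R.ofReal_re_add_im z, ← R.ofReal_re_add_im w]
  simp only [inner_add_left, inner_add_right, inner_smul_left, inner_smul_right, R.inner_ofReal,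
    Complex.conj_I]
  push_cast
  linear_combination -(inner ℝ (R.im z) (R.im w) : ℂ) * Complex.I_sq

theorem norm_sq_eq (z : E) : ‖z‖ ^ 2 = ‖R.re z‖ ^ 2 + ‖R.im z‖ ^ 2 := by
  rw [← inner_self_eq_norm_sq (𝕜 := ℂ) z, R.inner_eq z z, real_inner_self_eq_norm_sq,
    real_inner_self_eq_norm_sq, real_inner_comm (R.re z) (R.im z), sub_self, Complex.ofReal_zero,
    zero_mul, add_zero]
  exact Complex.ofReal_re _

theorem norm_ofReal (f : H) : ‖R.ofReal f‖ = ‖f‖ := by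
  have h := R.norm_sq_eq (R.ofReal f)
  rw [R.re_ofReal, R.im_ofReal, norm_zero, zero_pow two_ne_zero, add_zero] at h
  exact (sq_eq_sq₀ (norm_nonneg _) (norm_nonneg _)).1 h

theorem norm_re_le (z : E) : ‖R.re z‖ ≤ ‖z‖ :=
  le_of_sq_le_sq (by rw [R.norm_sq_eq z]; nlinarith [sq_nonneg ‖R.im z‖]) (norm_nonneg _)

theorem norm_im_le (z : E) : ‖R.im z‖ ≤ ‖z‖ :=
  le_of_sq_le_sq (by rw [R.norm_sq_eq z]; nlinarith [sq_nonneg ‖R.re z‖]) (norm_nonneg _)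

/-- The complex-linear extension of a real contraction. -/
noncomputable def complexify (A : H →L[ℝ] H) (hA : ‖A‖ ≤ 1) : E →L[ℂ] E :=
  LinearMap.mkContinuous
    { toFun := fun z => R.ofReal (A (R.re z)) + Complex.I • R.ofReal (A (R.im z))
      map_add' := fun z w => by
        simp only [map_add, smul_add]
        abel
      map_smul' := fun c z => by
        refine R.ext ?_ ?_
        · rw [RingHom.id_apply, R.re_mk, R.re_smul, R.re_smul, R.re_mk, R.im_mk, map_sub, map_smul,
            map_smul]
        · rw [RingHom.id_apply, R.im_mk, R.im_smul, R.im_smul, R.re_mk, R.im_mk, map_add, map_smul,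
            map_smul] } 1 fun z => by
    rw [one_mul]
    refine le_of_sq_le_sq ?_ (norm_nonneg _)
    rw [R.norm_sq_eq z, R.norm_sq_eq]
    simp only [LinearMap.coe_mk, AddHom.coe_mk, R.re_mk, R.im_mk]
    have h : ∀ f, ‖A f‖ ^ 2 ≤ ‖f‖ ^ 2 := fun f =>
      pow_le_pow_left₀ (norm_nonneg _) (by simpa using A.le_of_opNorm_le hA f) 2
    exact add_le_add (h _) (h _)

theorem re_complexify (A : H →L[ℝ] H) (hA : ‖A‖ ≤ 1) (z : E) :
    R.re (R.complexify A hA z) = A (R.re z) := R.re_mk _ _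

theorem im_complexify (A : H →L[ℝ] H) (hA : ‖A‖ ≤ 1) (z : E) :
    R.im (R.complexify A hA z) = A (R.im z) := R.im_mk _ _

theorem norm_complexify_le (A : H →L[ℝ] H) (hA : ‖A‖ ≤ 1) : ‖R.complexify A hA‖ ≤ 1 :=
  LinearMap.mkContinuous_norm_le _ zero_le_one _

theorem isPositive_complexify {A : H →L[ℝ] H} (hpos : A.IsPositive) (hA : ‖A‖ ≤ 1) :
    (R.complexify A hA).IsPositive := by
  refine ContinuousLinearMap.isPositive_def.2 ⟨fun z w => ?_, fun z => ?_⟩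
  · have h : ∀ f g, inner ℝ (A f) g = inner ℝ f (A g) := fun f g => hpos.isSymmetric f g
    simp only [ContinuousLinearMap.coe_coe, R.inner_eq, re_complexify, im_complexify, h]
  · have h : ∀ f, 0 ≤ inner ℝ (A f) f := fun f => hpos.2 f
    rw [ContinuousLinearMap.reApplyInnerSelf, R.inner_eq, re_complexify, im_complexify]
    simpa using add_nonneg (h (R.re z)) (h (R.im z))

/-- The real part of a complex-linear operator, restricted to real vectors. -/
noncomputable def restrict (X : E →L[ℂ] E) : H →L[ℝ] H :=
  LinearMap.mkContinuous
    { toFun := fun f => R.re (X (R.ofReal f))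
      map_add' := fun f g => by simp only [map_add]
      map_smul' := fun r f => by
        rw [R.ofReal_smul, map_smul, R.re_smul]
        simp } ‖X‖ fun f => by
    refine (R.norm_re_le _).trans ((X.le_opNorm _).trans ?_)
    rw [R.norm_ofReal]

theorem restrict_apply (X : E →L[ℂ] E) (f : H) : R.restrict X f = R.re (X (R.ofReal f)) := rfl

theorem norm_restrict_apply_le (X : E →L[ℂ] E) (f : H) : ‖R.restrict X f‖ ≤ ‖X‖ * ‖f‖ := by
  refine (R.norm_re_le _).trans ((X.le_opNorm _).trans ?_)
  rw [R.norm_ofReal]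

/-- The real `C⋆`-algebra of the operators that map real vectors to real vectors. -/
def realOperators [CompleteSpace E] : StarSubalgebra ℝ (E →L[ℂ] E) where
  carrier := {X | ∀ f, R.im (X (R.ofReal f)) = 0}
  mul_mem' {X Y} hX hY f := by
    have h := R.ofReal_re_add_im (Y (R.ofReal f))
    rw [hY f, map_zero, smul_zero, add_zero] at h
    rw [mul_apply_eq_comp, ← h]
    exact hX _
  add_mem' {X Y} hX hY f := by
    rw [add_apply, map_add, hX f, hY f, add_zero]
  algebraMap_mem' r f := by
    rw [Algebra.algebraMap_eq_smul_one]
    change R.im ((r : ℂ) • R.ofReal f) = 0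
    rw [R.im_smul, R.im_ofReal, R.re_ofReal]
    simp
  star_mem' {X} hX f := by
    refine ext_inner_left ℝ fun g => ?_
    have h := ContinuousLinearMap.adjoint_inner_right X (R.ofReal g) (R.ofReal f)
    have h' := congrArg Complex.im h
    rw [R.inner_eq, R.inner_eq, hX g] at h'
    rw [ContinuousLinearMap.star_eq_adjoint]
    simpa [R.re_ofReal, R.im_ofReal] using h'

theorem mem_realOperators [CompleteSpace E] {X : E →L[ℂ] E} :
    X ∈ R.realOperators ↔ ∀ f, R.im (X (R.ofReal f)) = 0 := Iff.rfl

theorem isClosed_realOperators [CompleteSpace E] :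
    IsClosed (R.realOperators : Set (E →L[ℂ] E)) := by
  have h : (R.realOperators : Set (E →L[ℂ] E)) =
      ⋂ f, {X : E →L[ℂ] E | R.im (X (R.ofReal f)) = 0} := by
    ext X
    simp [mem_realOperators]
  rw [h]
  refine isClosed_iInter fun f => ?_
  have him : Continuous R.im := by
    refine (AddMonoidHomClass.lipschitz_of_bound R.im 1 fun z => ?_).continuous
    rw [one_mul]
    exact R.norm_im_le z
  exact isClosed_eq (him.comp (ContinuousLinearMap.apply ℂ E (R.ofReal f)).continuous)
    continuous_const

theorem complexify_mem_realOperators [CompleteSpace E] (A : H →L[ℝ] H) (hA : ‖A‖ ≤ 1) :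
    R.complexify A hA ∈ R.realOperators := fun f => by
  rw [im_complexify, R.im_ofReal, map_zero]

theorem ofReal_restrict [CompleteSpace E] {X : E →L[ℂ] E} (hX : X ∈ R.realOperators) (f : H) :
    R.ofReal (R.restrict X f) = X (R.ofReal f) :=
  R.ext (by rw [R.re_ofReal, restrict_apply]) (by rw [R.im_ofReal, hX f])

theorem ofReal_injective : Function.Injective R.ofReal := fun f g h => by
  rw [← R.re_ofReal f, h, R.re_ofReal]

end RealStructure

end Complexification

section Semigroup

variable {H E : Type*} [NormedAddCommGroup H] [InnerProductSpace ℝ H]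
  [NormedAddCommGroup E] [InnerProductSpace ℂ E] [CompleteSpace E]

/-- The semigroup `e^{-tL}` on a real Hilbert space, for `L = A⁻¹ - 1`, obtained from the
continuous functional calculus for the complexification of `A`. Functions of a real operator are
real because the real operators form a closed star subalgebra. The last two bounds compare the
difference quotient of the semigroup at `t = 0` with its limit `L` on the ranges of `A` and
`A ^ 2`. -/
theorem RealStructure.exists_semigroup_estimates (R : RealStructure H E) {A : H →L[ℝ] H}
    (hpos : A.IsPositive) (hA : ‖A‖ ≤ 1) :
    ∃ S : ℝ → H →L[ℝ] H,
      (∀ t f g, inner ℝ (S t f) g = inner ℝ f (S t g)) ∧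
      (∀ s t, 0 < s → 0 < t → ∀ f, S (s + t) f = S s (S t f)) ∧
      (∀ t, 0 < t → ∀ f, ‖S t f‖ ≤ ‖f‖) ∧
      (∀ t f, S t (A f) = A (S t f)) ∧
      (∀ t, 0 < t → ∀ f, ‖A f - S t (A f)‖ ≤ t * ‖f‖) ∧
      (∀ t, 0 < t → ∀ f, ‖A (A f) - S t (A (A f)) - t • (A f - A (A f))‖ ≤ t ^ 2 * ‖f‖) := by
  set a := R.complexify A hA with ha
  have ha0 : a.IsPositive := R.isPositive_complexify hpos hA
  have hsa : IsSelfAdjoint a := ha0.isSelfAdjoint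
  have hmem : a ∈ R.realOperators := R.complexify_mem_realOperators A hA
  have : IsClosed (R.realOperators : Set (E →L[ℂ] E)) := R.isClosed_realOperators
  have hspec : ∀ s ∈ spectrum ℝ a, 0 ≤ s ∧ s ≤ 1 := fun s hs => by
    refine ⟨spectrum_nonneg_of_nonneg ((ContinuousLinearMap.nonneg_iff_isPositive a).2 ha0) hs, ?_⟩
    have h := norm_apply_le_norm_cfc (fun s : ℝ => s) a hs
    rw [cfc_id' ℝ a] at h
    exact (le_abs_self s).trans (h.trans (R.norm_complexify_le A hA))
  have hX : ∀ t, cfc (heatSymbol t) a ∈ R.realOperators := fun t => cfc_mem _ hmem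
  have hXsa : ∀ t, IsSelfAdjoint (cfc (heatSymbol t) a) := fun t => cfc_predicate _ _
  have hcomm : ∀ t, cfc (heatSymbol t) a * a = a * cfc (heatSymbol t) a := fun t =>
    by simpa only [cfc_id' ℝ a] using (cfc_commute_cfc (heatSymbol t) (fun s => s) a).eq
  have haA : ∀ f, a (R.ofReal f) = R.ofReal (A f) := fun f =>
    R.ext (by rw [ha, R.re_complexify, R.re_ofReal, R.re_ofReal])
      (by rw [ha, R.im_complexify, R.im_ofReal, R.im_ofReal, map_zero])
  have hXS : ∀ t f, cfc (heatSymbol t) a (R.ofReal f) =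
      R.ofReal (R.restrict (cfc (heatSymbol t) a) f) := fun t f => (R.ofReal_restrict (hX t) f).symm
  refine ⟨fun t => R.restrict (cfc (heatSymbol t) a), fun t f g => ?_, fun s t hs ht f => ?_,
    fun t ht f => ?_, fun t f => ?_, fun t ht f => ?_, fun t ht f => ?_⟩
  · have h : inner ℂ (cfc (heatSymbol t) a (R.ofReal f)) (R.ofReal g) =
        inner ℂ (R.ofReal f) (cfc (heatSymbol t) a (R.ofReal g)) := (hXsa t).isSymmetric _ _
    rw [hXS, hXS, R.inner_ofReal, R.inner_ofReal] at h
    exact Complex.ofReal_injective h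
  · refine R.ofReal_injective ?_
    rw [← hXS, cfc_heatSymbol_add hspec hs ht, mul_apply_eq_comp, hXS, hXS]
  · refine (R.norm_restrict_apply_le _ f).trans ?_
    exact mul_le_of_le_one_left (norm_nonneg _) (norm_cfc_heatSymbol_le hspec ht)
  · refine R.ofReal_injective ?_
    rw [← hXS, ← haA, ← haA, ← hXS, ← mul_apply_eq_comp, hcomm]
    rfl
  · have h := (a - cfc (heatSymbol t) a * a).le_of_opNorm_le
      (norm_sub_cfc_heatSymbol_mul_le hsa hspec ht) (R.ofReal f)
    rwa [sub_apply, mul_apply_eq_comp, haA, hXS, ← map_sub,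
      R.norm_ofReal, R.norm_ofReal] at h
  · have h := ((a - cfc (heatSymbol t) a * a - t • (1 - a)) * a).le_of_opNorm_le
      (norm_sub_cfc_heatSymbol_mul_sub_mul_le hsa hspec ht) (R.ofReal f)
    rw [mul_apply_eq_comp, sub_apply,
      sub_apply, mul_apply_eq_comp] at h
    change ‖_ - _ - (t : ℂ) • (a (R.ofReal f) - a (a (R.ofReal f)))‖ ≤ _ at h
    rwa [haA, haA, hXS, ← map_sub, ← map_sub, ← R.ofReal_smul, ← map_sub,
      R.norm_ofReal, R.norm_ofReal] at h

/-- A uniformly bounded family of operators tends strongly to zero if it does so on the range of an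
operator with dense range. -/
theorem tendsto_zero_of_denseRange {H : Type*} [NormedAddCommGroup H] [NormedSpace ℝ H]
    {A : H →L[ℝ] H} (hA : DenseRange A) {B : ℝ → H →L[ℝ] H} {C : ℝ}
    (hB : ∀ t, 0 < t → ∀ f, ‖B t f‖ ≤ C * ‖f‖)
    (hBA : ∀ f, Tendsto (fun t => B t (A f)) (𝓝[>] 0) (𝓝 0)) (f : H) :
    Tendsto (fun t => B t f) (𝓝[>] 0) (𝓝 0) := by
  rw [Metric.tendsto_nhds]
  intro ε hε
  obtain ⟨g, hg⟩ := hA.exists_dist_lt f (ε := ε / (2 * (|C| + 1))) (by positivity)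
  filter_upwards [Metric.tendsto_nhds.1 (hBA g) (ε / 2) (by positivity), self_mem_nhdsWithin]
    with t h1 ht
  rw [dist_zero_right] at h1 ⊢
  rw [dist_eq_norm, lt_div_iff₀ (by positivity)] at hg
  have h2 := hB t ht (f - A g)
  have h3 : ‖B t f‖ ≤ ‖B t (f - A g)‖ + ‖B t (A g)‖ := by
    rw [map_sub]
    simpa using norm_add_le (B t f - B t (A g)) (B t (A g))
  nlinarith [norm_nonneg (f - A g), le_abs_self C,
    mul_le_mul_of_nonneg_right (le_abs_self C) (norm_nonneg (f - A g))]

/-- Every injective positive contraction `A` on a real Hilbert space is the resolvent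
`(1 + L)⁻¹` of the generator `-L` of a strongly continuous semigroup of symmetric contractions. -/
theorem RealStructure.exists_semigroup [CompleteSpace H] (R : RealStructure H E) {A : H →L[ℝ] H}
    (hpos : A.IsPositive) (hA : ‖A‖ ≤ 1) (hinj : ∀ f, A f = 0 → f = 0) :
    ∃ S : ℝ → H →L[ℝ] H,
      (∀ t f g, inner ℝ (S t f) g = inner ℝ f (S t g)) ∧
      (∀ s t, 0 < s → 0 < t → ∀ f, S (s + t) f = S s (S t f)) ∧
      (∀ t, 0 < t → ∀ f, ‖S t f‖ ≤ ‖f‖) ∧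
      (∀ f, Tendsto (fun t => S t f - f) (𝓝[>] 0) (𝓝 0)) ∧
      ∀ u w, Tendsto (fun t : ℝ => t⁻¹ • (u - S t u) - w) (𝓝[>] 0) (𝓝 0) ↔ A (u + w) = u := by
  obtain ⟨S, h1, h2, h3, h4, h5, h6⟩ := R.exists_semigroup_estimates hpos hA
  have hdense : DenseRange A := by
    have h : A.range.topologicalClosure = ⊤ := by
      rw [Submodule.topologicalClosure_eq_top_iff, ContinuousLinearMap.orthogonal_range,
        ContinuousLinearMap.isSelfAdjoint_iff'.1 hpos.isSelfAdjoint, LinearMap.ker_eq_bot']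
      exact hinj
    exact Submodule.dense_iff_topologicalClosure_eq_top.2 h
  have ht0 : Tendsto (fun t : ℝ => t) (𝓝[>] 0) (𝓝 0) :=
    tendsto_nhdsWithin_of_tendsto_nhds tendsto_id
  have hA1 : ∀ f, ‖A f‖ ≤ ‖f‖ := fun f => by simpa using A.le_of_opNorm_le hA f
  -- the difference quotient converges on the range of `A`
  have hgen : ∀ f, Tendsto (fun t : ℝ => t⁻¹ • (A f - S t (A f)) - (f - A f)) (𝓝[>] 0) (𝓝 0) := by
    intro f
    let B : ℝ → H →L[ℝ] H := fun t => t⁻¹ • (A - S t ∘L A) - (1 - A)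
    refine tendsto_zero_of_denseRange (B := B) (C := 3) hdense (fun t ht f => ?_) (fun f => ?_) f
    · change ‖t⁻¹ • (A f - S t (A f)) - (f - A f)‖ ≤ 3 * ‖f‖
      have h7 : ‖t⁻¹ • (A f - S t (A f))‖ ≤ ‖f‖ := by
        rw [norm_smul, norm_inv, Real.norm_of_nonneg ht.le, inv_mul_le_iff₀ ht]
        exact h5 t ht f
      have h8 := norm_sub_le (t⁻¹ • (A f - S t (A f))) (f - A f)
      have h9 := norm_sub_le f (A f)
      linarith [hA1 f]
    · have h7 : Tendsto (fun t => t * ‖f‖) (𝓝[>] 0) (𝓝 0) := by simpa using ht0.mul_const ‖f‖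
      refine squeeze_zero_norm' (eventually_nhdsWithin_of_forall fun t (ht : 0 < t) => ?_) h7
      change ‖t⁻¹ • (A (A f) - S t (A (A f))) - (A f - A (A f))‖ ≤ _
      have h8 : t⁻¹ • (A (A f) - S t (A (A f))) - (A f - A (A f)) =
          t⁻¹ • (A (A f) - S t (A (A f)) - t • (A f - A (A f))) := by
        rw [smul_sub t⁻¹ _ (t • _), inv_smul_smul₀ ht.ne']
      rw [h8, norm_smul, norm_inv, Real.norm_of_nonneg ht.le, inv_mul_le_iff₀ ht]
      refine (h6 t ht f).trans (le_of_eq ?_)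
      ring
  refine ⟨S, h1, h2, h3, ?_, fun u w => ⟨fun h => ?_, fun h => ?_⟩⟩
  · refine tendsto_zero_of_denseRange (B := fun t => S t - 1) (C := 2) hdense
      (fun t ht f => ?_) fun f => ?_
    · change ‖S t f - f‖ ≤ 2 * ‖f‖
      have := norm_sub_le (S t f) f
      linarith [h3 t ht f]
    · have h7 : Tendsto (fun t => t * ‖f‖) (𝓝[>] 0) (𝓝 0) := by simpa using ht0.mul_const ‖f‖
      refine squeeze_zero_norm' (eventually_nhdsWithin_of_forall fun t (ht : 0 < t) => ?_) h7
      change ‖S t (A f) - A f‖ ≤ _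
      rw [norm_sub_rev]
      exact h5 t ht f
  · -- apply `A` to the difference quotient of `u`, which is then that of `A u`
    have h7 := (A.continuous.tendsto _).comp h
    have h8 := (hgen u).sub h7
    rw [map_zero, sub_zero] at h8
    have h9 : ∀ t : ℝ, t⁻¹ • (A u - S t (A u)) - (u - A u) - A (t⁻¹ • (u - S t u) - w) =
        A (u + w) - u := fun t => by
      rw [map_sub, map_smul, map_sub, h4, map_add]
      abel
    simp only [Function.comp_apply, h9] at h8
    exact sub_eq_zero.1 (tendsto_nhds_unique tendsto_const_nhds h8)
  · have h7 := hgen (u + w)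
    rwa [h, add_sub_cancel_left] at h7

end Semigroup

/-- `ℓ²(V, ℂ)` is the complexification of `ℓ²(V, ℝ)`. -/
noncomputable def lpRealStructure (V : Type*) :
    RealStructure (lp (fun _ : V => ℝ) 2) (lp (fun _ : V => ℂ) 2) where
  ofReal := (lp.mapCLM 2 (fun _ : V => Complex.ofRealCLM) zero_le_one
    fun _ => Complex.ofRealCLM_norm.le).toLinearMap.toAddMonoidHom
  re := (lp.mapCLM 2 (fun _ : V => Complex.reCLM) zero_le_one
    fun _ => Complex.reCLM_norm.le).toLinearMap.toAddMonoidHom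
  im := (lp.mapCLM 2 (fun _ : V => Complex.imCLM) zero_le_one
    fun _ => Complex.imCLM_norm.le).toLinearMap.toAddMonoidHom
  re_ofReal f := by
    ext x
    exact Complex.ofReal_re _
  im_ofReal f := by
    ext x
    exact Complex.ofReal_im (f x)
  ofReal_re_add_im z := by
    ext x
    change ((z x).re : ℂ) + Complex.I * ((z x).im : ℂ) = z x
    rw [mul_comm]
    exact Complex.re_add_im _
  re_smul c z := by
    ext x
    exact Complex.mul_re _ _
  im_smul c z := by
    ext x
    exact Complex.mul_im _ _
  inner_ofReal f g := by
    rw [lp.inner_eq_tsum, lp.inner_eq_tsum, Complex.ofReal_tsum]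
    refine tsum_congr fun x => ?_
    change (g x : ℂ) * (starRingEnd ℂ) (f x : ℂ) = _
    rw [Complex.conj_ofReal, RCLike.inner_apply, conj_trivial, Complex.ofReal_mul]

/-! ### The resolvent of the graph Laplacian -/

namespace WeightedGraph

variable {V : Type*} (G : WeightedGraph V) {m : V → ℝ} (hm : ∀ x, 0 < m x)

/-- The graph `φ ↦ (φ, dφ)` of the gradient on the finitely supported functions, in
`ℓ²(V) × ℓ²(V × V)`. Its norm is the form norm. -/
noncomputable def graphMap :
    G.finSupp →ₗ[ℝ] WithLp 2 (lp (fun _ : V => ℝ) 2 × lp (fun _ : V × V => ℝ) 2) where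
  toFun φ := WithLp.toLp 2
    (toL2 m hm ⟨((φ : G.energySpace) : V → ℝ), mem_ellTwo_of_finite_support m φ.2⟩, G.gradient φ)
  map_add' φ ψ := by
    have h : (⟨((φ + ψ : G.finSupp) : G.energySpace), mem_ellTwo_of_finite_support m (φ + ψ).2⟩ :
        ellTwo m) = ⟨((φ : G.energySpace) : V → ℝ), mem_ellTwo_of_finite_support m φ.2⟩ +
          ⟨((ψ : G.energySpace) : V → ℝ), mem_ellTwo_of_finite_support m ψ.2⟩ := rfl
    rw [h, map_add, Submodule.coe_add, map_add]
    rfl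
  map_smul' c φ := by
    have h : (⟨((c • φ : G.finSupp) : G.energySpace), mem_ellTwo_of_finite_support m (c • φ).2⟩ :
        ellTwo m) = c • ⟨((φ : G.energySpace) : V → ℝ), mem_ellTwo_of_finite_support m φ.2⟩ := rfl
    rw [h, map_smul, Submodule.coe_smul, map_smul]
    rfl

/-- The form domain `D(Q^D)`, as the graph of the closure of the gradient on finitely supported
functions. -/
noncomputable def formGraph :
    Submodule ℝ (WithLp 2 (lp (fun _ : V => ℝ) 2 × lp (fun _ : V × V => ℝ) 2)) :=
  (LinearMap.range (G.graphMap hm)).topologicalClosure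

instance : CompleteSpace (G.formGraph hm) :=
  (LinearMap.range (G.graphMap hm)).isClosed_topologicalClosure.completeSpace_coe

theorem mem_formGraph {z : WithLp 2 (lp (fun _ : V => ℝ) 2 × lp (fun _ : V × V => ℝ) 2)} :
    z ∈ G.formGraph hm ↔ ∃ (u : G.energySpace) (u' : ellTwo m), (u : V → ℝ) = u' ∧
      G.MemFormDomain m u ∧ z = WithLp.toLp 2 (toL2 m hm u', G.gradient u) := by
  have hcont := WithLp.prod_continuous_ofLp 2 (lp (fun _ : V => ℝ) 2) (lp (fun _ : V × V => ℝ) 2)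
  have hcont' := WithLp.prod_continuous_toLp 2 (lp (fun _ : V => ℝ) 2) (lp (fun _ : V × V => ℝ) 2)
  have hclosure : z ∈ G.formGraph hm ↔ z ∈ closure (LinearMap.range (G.graphMap hm) : Set _) :=
    Iff.rfl
  rw [hclosure, mem_closure_iff_seq_limit]
  constructor
  · rintro ⟨ζ, hζ, hlim⟩
    choose φ hφ using hζ
    let φ' : ℕ → ellTwo m := fun n =>
      ⟨((φ n : G.energySpace) : V → ℝ), mem_ellTwo_of_finite_support m (φ n).2⟩
    have h1 : Tendsto (fun n => toL2 m hm (φ' n)) atTop (𝓝 z.fst) := by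
      have h := ((continuous_fst.comp hcont).tendsto z).comp hlim
      refine h.congr fun n => ?_
      rw [Function.comp_apply, ← hφ n]
      rfl
    have h2 : Tendsto (fun n => G.gradient (φ n)) atTop (𝓝 z.snd) := by
      have h := ((continuous_snd.comp hcont).tendsto z).comp hlim
      refine h.congr fun n => ?_
      rw [Function.comp_apply, ← hφ n]
      rfl
    have h3 : ∀ x, Tendsto (fun n => ((φ n : G.energySpace) : V → ℝ) x) atTop
        (𝓝 (((toL2 m hm).symm z.fst : V → ℝ) x)) := fun x => by
      have h := (((lp.evalCLM ℝ (fun _ : V => ℝ) 2 x).continuous.tendsto _).comp h1).div_const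
        (√(m x))
      refine h.congr fun n => ?_
      exact mul_div_cancel_right₀ _ (Real.sqrt_pos.2 (hm x)).ne'
    obtain ⟨hv, hve⟩ := G.exists_gradient_eq_of_tendsto h3 h2
    refine ⟨⟨_, hv⟩, (toL2 m hm).symm z.fst, rfl, ?_, ?_⟩
    · refine (memFormDomain_iff hm ⟨_, hv⟩ ((toL2 m hm).symm z.fst) rfl).2
        ⟨fun n => φ n, φ', fun n => (φ n).2, fun n => rfl, ?_, ?_⟩
      · rwa [hve]
      · rwa [LinearEquiv.apply_symm_apply]
    · rw [hve, LinearEquiv.apply_symm_apply]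
      rfl
  · rintro ⟨u, u', h, hu, rfl⟩
    obtain ⟨φ, φ', hφ, hφφ', h1, h2⟩ := (memFormDomain_iff hm u u' h).1 hu
    refine ⟨fun n => G.graphMap hm ⟨φ n, hφ n⟩, fun n => ⟨_, rfl⟩, ?_⟩
    have h3 := (hcont'.tendsto _).comp (h2.prodMk_nhds h1)
    refine h3.congr fun n => ?_
    have h4 : φ' n = ⟨(φ n : V → ℝ), mem_ellTwo_of_finite_support m (hφ n)⟩ :=
      Subtype.ext (hφφ' n).symm
    rw [Function.comp_apply, h4]
    rfl

/-- The isometric inclusion of `ℓ²(V)` into `ℓ²(V) × ℓ²(V × V)`. -/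
noncomputable def inclFst (V : Type*) : lp (fun _ : V => ℝ) 2 →L[ℝ]
    WithLp 2 (lp (fun _ : V => ℝ) 2 × lp (fun _ : V × V => ℝ) 2) :=
  LinearMap.mkContinuous
    { toFun := fun f => WithLp.toLp 2 (f, 0)
      map_add' := fun f g => by
        rw [← WithLp.toLp_add, Prod.mk_add_mk, add_zero]
      map_smul' := fun c f => by
        rw [RingHom.id_apply, ← WithLp.toLp_smul, Prod.smul_mk, smul_zero] } 1 fun f => by
    simp

theorem inclFst_apply (f : lp (fun _ : V => ℝ) 2) :
    inclFst V f = WithLp.toLp 2 (f, 0) := rfl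

theorem norm_inclFst_le : ‖inclFst V‖ ≤ 1 := LinearMap.mkContinuous_norm_le _ zero_le_one _

/-- The resolvent `(1 + L)⁻¹`: the first component of the orthogonal projection of `(f, 0)` to the
graph of the gradient. This is the Riesz representation of `⟨f, ·⟩` for the form inner product. -/
noncomputable def resolvent : lp (fun _ : V => ℝ) 2 →L[ℝ] lp (fun _ : V => ℝ) 2 :=
  ContinuousLinearMap.adjoint (inclFst V) ∘L (G.formGraph hm).starProjection ∘L inclFst V

theorem isPositive_resolvent : (G.resolvent hm).IsPositive :=
  (ContinuousLinearMap.IsPositive.of_isStarProjection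
    isStarProjection_starProjection).adjoint_conj _

theorem norm_resolvent_le : ‖G.resolvent hm‖ ≤ 1 := by
  have h1 := ContinuousLinearMap.opNorm_comp_le (ContinuousLinearMap.adjoint (inclFst V))
    ((G.formGraph hm).starProjection ∘L inclFst V)
  have h2 := ContinuousLinearMap.opNorm_comp_le (G.formGraph hm).starProjection (inclFst V)
  have h3 : ‖ContinuousLinearMap.adjoint (inclFst V)‖ ≤ 1 := by
    rw [LinearIsometryEquiv.norm_map]
    exact norm_inclFst_le
  have h4 := mul_le_one₀ (G.formGraph hm).starProjection_norm_le (norm_nonneg _)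
    (norm_inclFst_le (V := V))
  exact h1.trans (mul_le_one₀ h3 (norm_nonneg _) (h2.trans h4))

theorem resolvent_apply (f : lp (fun _ : V => ℝ) 2) :
    G.resolvent hm f = ((G.formGraph hm).starProjection (inclFst V f)).fst := by
  refine ext_inner_right ℝ fun g => ?_
  rw [resolvent, ContinuousLinearMap.comp_apply, ContinuousLinearMap.adjoint_inner_left,
    WithLp.prod_inner_apply, inclFst_apply]
  simp

/-- `L u = w` if and only if `u = (1 + L)⁻¹ (u + w)`. -/
theorem isOperatorValue_iff (u w : ellTwo m) :
    G.IsOperatorValue m u w ↔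
      G.resolvent hm (toL2 m hm u + toL2 m hm w) = toL2 m hm u := by
  rw [resolvent_apply]
  constructor
  · rintro ⟨hu, h⟩
    refine congrArg WithLp.fst (Submodule.eq_starProjection_of_mem_of_inner_eq_zero
      (v := WithLp.toLp 2 (toL2 m hm u, G.gradient ⟨u, hu.1⟩)) ?_ ?_)
    · exact (G.mem_formGraph hm).2 ⟨⟨u, hu.1⟩, u, rfl, hu, rfl⟩
    · intro z hz
      obtain ⟨v, v', hvv, hv, rfl⟩ := (G.mem_formGraph hm).1 hz
      have h1 := h v hv
      rw [hvv, pairing_eq_inner hm, ← hvv, G.form_eq_inner ⟨u, hu.1⟩ v] at h1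
      rw [WithLp.prod_inner_apply, inclFst_apply]
      simp only [WithLp.ofLp_sub, Prod.fst_sub, Prod.snd_sub, add_sub_cancel_left, zero_sub,
        inner_neg_left]
      rw [h1, add_neg_cancel]
  · intro h
    obtain ⟨v, v', hvv, hv, hP⟩ := (G.mem_formGraph hm).1
      ((G.formGraph hm).starProjection_apply_mem (inclFst V (toL2 m hm u + toL2 m hm w)))
    rw [hP] at h
    obtain rfl : v' = u := (toL2 m hm).injective h
    refine ⟨hvv ▸ hv, fun x hx => ?_⟩
    have h1 := (G.formGraph hm).starProjection_inner_eq_zero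
      (inclFst V (toL2 m hm v' + toL2 m hm w)) _
      ((G.mem_formGraph hm).2 ⟨⟨x, hx.1⟩, ⟨x, hx.2.1⟩, rfl, hx, rfl⟩)
    rw [hP, WithLp.prod_inner_apply, inclFst_apply] at h1
    simp only [WithLp.ofLp_sub, Prod.fst_sub, Prod.snd_sub, add_sub_cancel_left, zero_sub,
        inner_neg_left] at h1
    have h2 := G.form_eq_inner v ⟨x, hx.1⟩
    have h3 := pairing_eq_inner hm w ⟨x, hx.2.1⟩
    rw [← hvv]
    change G.form v x = pairing m w x
    linarith

/-- The resolvent is injective: a gradient vanishes with its function, and finitely supported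
functions separate points. -/
theorem resolvent_injective {f : lp (fun _ : V => ℝ) 2} (h : G.resolvent hm f = 0) : f = 0 := by
  have h1 : G.IsOperatorValue m 0 ((toL2 m hm).symm f) := by
    rw [G.isOperatorValue_iff hm, map_zero, zero_add, LinearEquiv.apply_symm_apply, h]
  have h2 : (toL2 m hm).symm f = 0 := by
    ext x
    have h3 := h1.2 (deltaFun m x) (memFormDomain_of_finite_support
      ((Set.finite_singleton x).subset (by classical exact Pi.support_single_subset)))
    rw [pairing_eq_inner hm, real_inner_comm, inner_toL2_deltaFun] at h3
    have h4 : G.form ((0 : ellTwo m) : V → ℝ) (deltaFun m x) = 0 := by simp [form]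
    rw [h4, eq_comm, mul_eq_zero] at h3
    exact h3.resolve_right (hm x).ne'
  simpa using h2

/-- The semigroup `e^{-tL}` exists. -/
theorem exists_isAssociatedSemigroup (hm : ∀ x, 0 < m x) :
    ∃ T : ℝ → ellTwo m →ₗ[ℝ] ellTwo m, G.IsAssociatedSemigroup m T := by
  obtain ⟨S, h1, h2, h3, h4, h5⟩ := (lpRealStructure V).exists_semigroup
    (G.isPositive_resolvent hm) (G.norm_resolvent_le hm) fun f => G.resolvent_injective hm
  let J := toL2 m hm
  have hJ : ∀ t u, J (J.symm (S t (J u))) = S t (J u) := fun t u => J.apply_symm_apply _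
  have hpow : ∀ g : ℝ → lp (fun _ : V => ℝ) 2,
      Tendsto (fun t => ‖g t‖ ^ 2) (𝓝[>] 0) (𝓝 0) ↔ Tendsto g (𝓝[>] 0) (𝓝 0) := fun g => by
    rw [tendsto_zero_iff_norm_tendsto_zero (f := g)]
    refine ⟨fun h => ?_, fun h => by simpa using h.pow 2⟩
    simpa only [Real.sqrt_sq (norm_nonneg _), Real.sqrt_zero] using h.sqrt
  refine ⟨fun t => J.symm.toLinearMap ∘ₗ (S t).toLinearMap ∘ₗ J.toLinearMap, ?_, ?_, ?_, ?_, ?_⟩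
  · intro t _ f g
    rw [pairing_eq_inner hm, pairing_eq_inner hm]
    change inner ℝ (J (J.symm (S t (J f)))) (J g) = inner ℝ (J f) (J (J.symm (S t (J g))))
    rw [hJ, hJ, h1]
  · intro s t hs ht
    ext1 f
    change J.symm (S (s + t) (J f)) = J.symm (S s (J (J.symm (S t (J f)))))
    rw [hJ, h2 s t hs ht]
  · intro t ht f
    rw [pairing_self_eq_norm_sq hm, pairing_self_eq_norm_sq hm]
    change ‖J (J.symm (S t (J f)))‖ ^ 2 ≤ ‖J f‖ ^ 2
    rw [hJ]
    exact pow_le_pow_left₀ (norm_nonneg _) (h3 t ht _) 2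
  · intro f
    simp only [pairing_self_eq_norm_sq hm]
    rw [hpow]
    refine (h4 (J f)).congr fun t => ?_
    rw [map_sub]
    exact congrArg (· - J f) (hJ t f).symm
  · intro u w
    simp only [pairing_self_eq_norm_sq hm]
    rw [hpow, G.isOperatorValue_iff hm, ← h5]
    refine tendsto_congr fun t => ?_
    rw [map_sub, map_smul, map_sub]
    exact congrArg (fun z => t⁻¹ • (J u - z) - J w) (hJ t u)

end WeightedGraph

/-! ### Recurrence and the boundary term -/

theorem mainTheorem8 {V : Type*} [Countable V] [Infinite V] (G : WeightedGraph V)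
    (hG : G.Connected) (m : V → ℝ) (hm : ∀ x, 0 < m x) :
    G.IsRecurrent m ↔
      ∀ u ∈ G.DInfty, ∀ v ∈ G.DOne m, G.boundaryTerm m u v = 0 := by
  constructor
  · rintro ⟨T, hT, hrec⟩ u hu v hv
    obtain ⟨o⟩ : Nonempty V := inferInstance
    exact (hT.nullCapacity hm o (hrec o o)).boundaryTerm_eq_zero hG hm hu hv
  · intro h
    obtain ⟨T, hT⟩ := G.exists_isAssociatedSemigroup hm
    exact ⟨T, hT, fun x y => hT.setLIntegral_eq_top hG hm
      (WeightedGraph.nullCapacity_of_boundaryTerm_eq_zero hG hm h x) y⟩
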